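/- Let $r \ge 3$. An $r$-graph is a set of $r$-element subsets (edges) of a finite vertex set. For $\ell \ge 2$, an $r$-graph contains a Berge $\ell$-cycle if there are distinct vertices $v_1,\dots,v_\ell$ and distinct edges $e_1,\dots,e_\ell$ of it with $v_i, v_{i+1} \in e_i$ for all $1 \le i \le \ell$ (indices modulo $\ell$). Its girth is the least $\ell \ge 2$ such that it contains a Berge $\ell$-cycle, and $\infty$ if it contains none. Let $H^r_{n,p}$ be the random $r$-graph on $n$ vertices in which each $r$-element set of vertices is an edge independently with probability $p$, and let $\mathrm{ex}(H^r_{n,p}, \mathcal{C}^r_{[3]})$ be the largest number of edges in a subgraph of $H^r_{n,p}$ of girth larger than $3$. Then there is a sequence $\varepsilon_n \to 0$ of real numbers, depending only on $r$, such that for every sequence $p = p(n) \in [0,1]$ with $p \ge n^{-r+3/2} (\log n)^{2r-3}$ for all sufficiently large $n$, $$p^{\frac{1}{2r-3}}\, n^{2-\varepsilon_n} \;\le\; \mathrm{ex}(H^r_{n,p}, \mathcal{C}^r_{[3]}) \;\le\; p^{\frac{1}{2r-3}}\, n^{2+\varepsilon_n}$$ holds with probability tending to $1$ as $n \to \infty$.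 -/

import Mathlib

open Filter Topology

/-- The edge set `H` on the vertex type `V` contains a Berge `ℓ`-cycle: there are distinct vertices
`v i` and distinct edges `e i` of `H`, indexed cyclically by `Fin ℓ`, with `v i, v (i + 1) ∈ e i`
(`finRotate ℓ` is the cyclic successor `i ↦ i + 1`). -/
def HasBergeCycle {V : Type*} (H : Set (Finset V)) (ℓ : ℕ) : Prop :=
  ∃ (v : Fin ℓ → V) (e : Fin ℓ → Finset V),
    Function.Injective v ∧ Function.Injective e ∧
      ∀ i, e i ∈ H ∧ v i ∈ e i ∧ v (finRotate ℓ i) ∈ e i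

/-- The girth: the least `ℓ ≥ 2` such that `H` contains a Berge `ℓ`-cycle, and `⊤` if there is
none. -/
noncomputable def bergeGirth {V : Type*} (H : Set (Finset V)) : ℕ∞ :=
  ⨅ ℓ ∈ {ℓ : ℕ | 2 ≤ ℓ ∧ HasBergeCycle H ℓ}, (ℓ : ℕ∞)

/-- The largest number of edges of a subgraph of `H` of girth larger than `ℓ`. -/
noncomputable def exGirth {V : Type*} (H : Set (Finset V)) (ℓ : ℕ) : ℕ :=
  sSup {m : ℕ | ∃ G ⊆ H, (ℓ : ℕ∞) < bergeGirth G ∧ G.ncard = m}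

/-- Over a finite vertex set the supremum defining `exGirth` is a maximum. -/
theorem isGreatest_exGirth {V : Type*} [Finite V] (H : Set (Finset V)) (ℓ : ℕ) :
    IsGreatest {m : ℕ | ∃ G ⊆ H, (ℓ : ℕ∞) < bergeGirth G ∧ G.ncard = m} (exGirth H ℓ) := by
  have hne : {m : ℕ | ∃ G ⊆ H, (ℓ : ℕ∞) < bergeGirth G ∧ G.ncard = m}.Nonempty := by
    refine ⟨0, ∅, Set.empty_subset _, ?_, Set.ncard_empty _⟩
    have h : bergeGirth (∅ : Set (Finset V)) = ⊤ := by
      simp only [bergeGirth, iInf_eq_top]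
      rintro k ⟨hk, v, e, -, -, he⟩
      exact absurd (he ⟨0, by omega⟩).1 (Set.notMem_empty _)
    rw [h]
    exact ENat.natCast_lt_top ℓ
  have hbd : BddAbove {m : ℕ | ∃ G ⊆ H, (ℓ : ℕ∞) < bergeGirth G ∧ G.ncard = m} := by
    refine ⟨H.ncard, ?_⟩
    rintro m ⟨G, hG, -, rfl⟩
    exact Set.ncard_le_ncard hG (Set.toFinite H)
  exact ⟨Nat.sSup_mem hne hbd, fun m hm => le_csSup hbd hm⟩

/-- The law of the random `r`-graph on `n` vertices in which each `r`-element subset of the vertex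
set is an edge independently with probability `p`, as a measure on edge sets. -/
noncomputable def randomRGraph (r n : ℕ) (p : unitInterval) :
    MeasureTheory.Measure (Set (Finset (Fin n))) :=
  ProbabilityTheory.setBernoulli {e : Finset (Fin n) | e.card = r} p

/-- The event `A n` for the random `r`-graph with edge probability `p n` on `n` vertices holds
asymptotically almost surely: its probability tends to `1` as `n → ∞`. -/
def RandomRGraphAAS (r : ℕ) (p : ℕ → unitInterval)
    (A : (n : ℕ) → Set (Finset (Fin n)) → Prop) : Prop :=
  Tendsto (fun n => (randomRGraph r n (p n)).real {H | A n H}) atTop (𝓝 1)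

/-! Put `θ = p ^ (1 / (2r - 3))`, so that the claim reads `θ n ^ (2 ± ε)`.

Upper bound: an `r`-graph of girth larger than `3` is encoded by a graph. In each edge pick two
vertices `a, b` and keep the `2r - 3` pairs inside the edge that meet `{a, b}`. Girth above `2`
keeps these pairs disjoint over distinct edges; girth above `3` allows the edges to be recovered,
because each further vertex `w` forms a triangle with `a` and `b`
(`card_filter_three_lt_bergeGirth_le`). As `p ^ m = θ ^ ((2r - 3) m)`, the first moment is at most
the expected number of graphs with `(2r - 3) m` edges in a binomial random graph of density `θ`,
which is tiny once `m ≥ θ n ^ 2` (`choose_mul_pow_le_half_pow`).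

Lower bound: a Behrend-type construction (`exists_isLinearTriangleFree`) gives an `r`-partite
`r`-graph of girth above `3` whose edge count is nearly quadratic in its number of vertices. Replace
each vertex by `s` copies. Berge cycles of length `2` and `3` in the blow-up lie over a single edge,
so they are few. Intersect with the random `r`-graph and delete an edge from each surviving short
cycle (`setBernoulli_real_exists_avoiding_ge`). With `s` about `1 / (θ ^ 2 log n)` the deletions are
negligible and about `s ^ r p` edges survive over each base edge; comparing with `n` gives `θ n ^ (2
- ε)`. The hypothesis on `p` says `θ ^ 2 n ≥ (log n) ^ 2`, so such a blow-up fits into `n` vertices.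

Both estimates are uniform in `p` for fixed `ε`; a diagonal choice then makes `ε` depend on `n` and
`r` only. -/

/-! ### Random subsets: moments and the alteration method. -/

open MeasureTheory ProbabilityTheory in
/-- A `p`-random subset of `u` contains a given finite subset `S` of `u` with probability
`p ^ #S`. -/
theorem setBernoulli_real_superset {ι : Type*} {u : Set ι} (p : unitInterval) (S : Finset ι)
    (hS : (S : Set ι) ⊆ u) :
    (setBernoulli u p).real {H | (S : Set ι) ⊆ H} = (p : ℝ) ^ S.card := by
  have h : (fun P : ι → Prop ↦ {i | P i}) ⁻¹' {H : Set ι | (S : Set ι) ⊆ H} =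
      Set.pi S (fun _ ↦ {True}) := by
    ext P
    simp [Set.subset_def, Set.mem_pi]
  rw [measureReal_def, setBernoulli_apply', h, Measure.infinitePi_pi _ (by simp)]
  have h2 : ∀ i ∈ S, ((unitInterval.toNNReal p • Measure.dirac (i ∈ u) +
      unitInterval.toNNReal (unitInterval.symm p) • Measure.dirac False : Measure Prop)) {True} =
      unitInterval.toNNReal p := by
    intro i hi
    have : i ∈ u := hS hi
    simp [this]
  rw [Finset.prod_congr rfl h2]
  simp

open MeasureTheory ProbabilityTheory in
/-- The expected number of members of a family of finite sets that are contained in a random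
set. -/
theorem integral_card_filter_subset_setBernoulli {ι : Type*} [Finite ι] {u : Set ι}
    (p : unitInterval) (B : Finset (Finset ι)) (hB : ∀ b ∈ B, (b : Set ι) ⊆ u) :
    ∫ H, ((open scoped Classical in (B.filter fun b : Finset ι ↦ (b : Set ι) ⊆ H).card : ℕ) : ℝ)
      ∂(setBernoulli u p) = ∑ b ∈ B, (p : ℝ) ^ b.card := by
  classical
  have h : ∀ H : Set ι, (((B.filter fun b : Finset ι ↦ (b : Set ι) ⊆ H).card : ℕ) : ℝ) =
      ∑ b ∈ B, {H : Set ι | (b : Set ι) ⊆ H}.indicator 1 H := by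
    intro H
    simp [Set.indicator_apply]
  simp_rw [h]
  rw [integral_finsetSum _ fun _ _ ↦ Integrable.of_finite]
  refine Finset.sum_congr rfl fun b hb ↦ ?_
  rw [integral_indicator_one (MeasurableSet.of_discrete),
    setBernoulli_real_superset p b (hB b hb)]

open MeasureTheory ProbabilityTheory in
/-- Lower tail of the number of elements of `F` contained in a random set, by Chebyshev. -/
theorem setBernoulli_real_card_filter_lt_le {ι : Type*} [Finite ι] {u : Set ι}
    (p : unitInterval) (F : Finset ι) (hF : (F : Set ι) ⊆ u) (hpos : 0 < F.card * (p : ℝ)) :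
    (setBernoulli u p).real {H | ((open scoped Classical in (F.filter (· ∈ H)).card : ℕ) : ℝ) <
      F.card * (p : ℝ) / 2} ≤ 4 / (F.card * (p : ℝ)) := by
  classical
  set μ := setBernoulli u p
  let X : Set ι → ℝ := fun H ↦ (((F.filter (· ∈ H)).card : ℕ) : ℝ)
  have hX : ∀ H, X H = ∑ e ∈ F, {H : Set ι | e ∈ H}.indicator 1 H := by
    intro H
    simp [X, Set.indicator_apply]
  have hp0 : (0 : ℝ) ≤ p := p.2.1
  have hp1 : (p : ℝ) ≤ 1 := p.2.2
  have hmean : ∫ H, X H ∂μ = F.card * (p : ℝ) := by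
    simp_rw [hX]
    rw [integral_finsetSum _ fun _ _ ↦ Integrable.of_finite]
    have : ∀ e ∈ F, ∫ H, {H : Set ι | e ∈ H}.indicator (1 : Set ι → ℝ) H ∂μ = p := by
      intro e he
      rw [integral_indicator_one (MeasurableSet.of_discrete)]
      have := setBernoulli_real_superset (u := u) p {e} (by simpa using hF he)
      simpa using this
    rw [Finset.sum_congr rfl this]
    simp
  have hsq : ∫ H, (X ^ 2) H ∂μ ≤ (F.card * (p : ℝ)) ^ 2 + F.card * (p : ℝ) := by
    have h1 : ∀ H, (X ^ 2) H =
        ∑ e ∈ F, ∑ f ∈ F, {H : Set ι | e ∈ H ∧ f ∈ H}.indicator 1 H := by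
      intro H
      rw [Pi.pow_apply, hX, sq, Finset.sum_mul_sum]
      refine Finset.sum_congr rfl fun e _ ↦ Finset.sum_congr rfl fun f _ ↦ ?_
      by_cases he : e ∈ H <;> by_cases hf : f ∈ H <;> simp [he, hf]
    simp_rw [h1]
    rw [integral_finsetSum _ fun _ _ ↦ Integrable.of_finite]
    have h2 : ∀ e ∈ F, ∫ H, ∑ f ∈ F, {H : Set ι | e ∈ H ∧ f ∈ H}.indicator (1 : Set ι → ℝ) H ∂μ ≤
        F.card * (p : ℝ) ^ 2 + p := by
      intro e he
      rw [integral_finsetSum _ fun _ _ ↦ Integrable.of_finite]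
      -- On the diagonal the true value is `p`; the surplus `p ^ 2` completes the row sum, and the
      -- variance still stays below the mean.
      have h3 : ∀ f ∈ F, ∫ H, {H : Set ι | e ∈ H ∧ f ∈ H}.indicator (1 : Set ι → ℝ) H ∂μ ≤
          (p : ℝ) ^ 2 + if e = f then (p : ℝ) else 0 := by
        intro f hf
        rw [integral_indicator_one (MeasurableSet.of_discrete)]
        have := setBernoulli_real_superset (u := u) p {e, f} (by
          intro x hx
          simp only [Finset.coe_insert, Finset.coe_singleton, Set.mem_insert_iff,
            Set.mem_singleton_iff] at hx
          rcases hx with rfl | rfl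
          exacts [hF he, hF hf])
        have h4 : {H : Set ι | ((({e, f} : Finset ι)) : Set ι) ⊆ H} = {H | e ∈ H ∧ f ∈ H} := by
          ext H
          simp [Set.insert_subset_iff]
        rw [h4] at this
        rw [this]
        split_ifs with h
        · subst h
          simp only [Finset.pair_eq_singleton, Finset.card_singleton, pow_one]
          nlinarith
        · rw [Finset.card_pair h]
          simp
      refine (Finset.sum_le_sum h3).trans ?_
      rw [Finset.sum_add_distrib, Finset.sum_ite_eq]
      simp [he]
    refine (Finset.sum_le_sum h2).trans ?_
    rw [Finset.sum_const, nsmul_eq_mul]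
    nlinarith
  have hvar : variance X μ ≤ F.card * (p : ℝ) := by
    rw [variance_eq_sub MemLp.of_discrete, hmean]
    linarith
  have hch := meas_ge_le_variance_div_sq (μ := μ) (X := X) MemLp.of_discrete (half_pos hpos)
  have hle : {H | X H < F.card * (p : ℝ) / 2} ⊆ {H | F.card * (p : ℝ) / 2 ≤ |X H - ∫ H, X H ∂μ|} := by
    intro H hH
    simp only [Set.mem_ofPred_eq] at hH ⊢
    rw [hmean, abs_sub_comm]
    exact le_trans (by linarith) (le_abs_self _)
  calc μ.real {H | X H < F.card * (p : ℝ) / 2}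
      ≤ μ.real {H | F.card * (p : ℝ) / 2 ≤ |X H - ∫ H, X H ∂μ|} := measureReal_mono hle
    _ ≤ variance X μ / (F.card * (p : ℝ) / 2) ^ 2 := by
        rw [measureReal_def]
        exact ENNReal.toReal_le_of_le_ofReal (div_nonneg (variance_nonneg _ _) (sq_nonneg _)) hch
    _ ≤ F.card * (p : ℝ) / (F.card * (p : ℝ) / 2) ^ 2 := by gcongr
    _ = 4 / (F.card * (p : ℝ)) := by field_simp; ring

/-- Deleting one element from each member of `B` inside `H` leaves a subset of `F ∩ H` that contains
no member of `B`. -/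
theorem exists_subset_card_le_card_add_card_filter_subset {ι : Type*} (H : Set ι)
    (F : Finset ι) (B : Finset (Finset ι)) (hB : ∀ b ∈ B, b.Nonempty) :
    ∃ G ⊆ F, (G : Set ι) ⊆ H ∧ (∀ b ∈ B, ¬ b ⊆ G) ∧
      (open scoped Classical in (F.filter (· ∈ H)).card) ≤
        G.card + (open scoped Classical in (B.filter fun b : Finset ι ↦ (b : Set ι) ⊆ H).card) := by
  classical
  rcases isEmpty_or_nonempty ι with hι | hι
  · refine ⟨∅, Finset.empty_subset _, by simp, fun b hb _ ↦ ?_, by simp [Finset.eq_empty_of_isEmpty]⟩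
    exact hι.elim (hB b hb).choose
  choose! f hf using hB
  refine ⟨F.filter (· ∈ H) \ (B.filter fun b : Finset ι ↦ (b : Set ι) ⊆ H).image f,
    Finset.sdiff_subset.trans (Finset.filter_subset _ _), ?_, ?_, ?_⟩
  · intro x hx
    simp only [Finset.coe_sdiff, Set.mem_sdiff, Finset.mem_coe, Finset.mem_filter] at hx
    exact hx.1.2
  · intro b hb hsub
    have hbH : (b : Set ι) ⊆ H := fun x hx ↦
      (Finset.mem_filter.1 (Finset.mem_sdiff.1 (hsub hx)).1).2
    exact (Finset.mem_sdiff.1 (hsub (hf b hb))).2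
      (Finset.mem_image_of_mem f (Finset.mem_filter.2 ⟨hb, hbH⟩))
  · calc (F.filter (· ∈ H)).card
        ≤ (F.filter (· ∈ H) \ (B.filter fun b : Finset ι ↦ (b : Set ι) ⊆ H).image f).card +
          ((B.filter fun b : Finset ι ↦ (b : Set ι) ⊆ H).image f).card :=
          Nat.sub_le_iff_le_add.1 (Finset.le_card_sdiff _ _)
      _ ≤ _ := by gcongr; exact Finset.card_image_le

open MeasureTheory ProbabilityTheory in
/-- The alteration method: a random set contains, with high probability, at least a quarter of the
expected number of elements of `F` that avoid all members of a family of small expected count. -/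
theorem setBernoulli_real_exists_avoiding_ge {ι : Type*} [Finite ι] {u : Set ι}
    (p : unitInterval) (F : Finset ι) (hF : (F : Set ι) ⊆ u) (hpos : 0 < F.card * (p : ℝ))
    (B : Finset (Finset ι)) (hB : ∀ b ∈ B, b ⊆ F) (hne : ∀ b ∈ B, b.Nonempty) :
    1 - (4 / (F.card * (p : ℝ)) + 4 * (∑ b ∈ B, (p : ℝ) ^ b.card) / (F.card * (p : ℝ))) ≤
      (setBernoulli u p).real {H | ∃ G ⊆ F, (G : Set ι) ⊆ H ∧ (∀ b ∈ B, ¬ b ⊆ G) ∧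
        F.card * (p : ℝ) / 4 ≤ G.card} := by
  classical
  set μ := setBernoulli u p
  set A := {H : Set ι | ∃ G ⊆ F, (G : Set ι) ⊆ H ∧ (∀ b ∈ B, ¬ b ⊆ G) ∧
        F.card * (p : ℝ) / 4 ≤ G.card}
  have h1 := setBernoulli_real_card_filter_lt_le p F hF hpos
  have h2 := mul_meas_ge_le_integral_of_nonneg (μ := μ)
    (f := fun H : Set ι ↦ (((B.filter fun b : Finset ι ↦ (b : Set ι) ⊆ H).card : ℕ) : ℝ))
    (Filter.Eventually.of_forall fun H ↦ by positivity) Integrable.of_finite (F.card * (p : ℝ) / 4)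
  rw [integral_card_filter_subset_setBernoulli p B
    fun b hb ↦ (Finset.coe_subset.2 (hB b hb)).trans hF] at h2
  set A1 := {H : Set ι | (((F.filter (· ∈ H)).card : ℕ) : ℝ) < F.card * (p : ℝ) / 2}
  set A2 := {H : Set ι | F.card * (p : ℝ) / 4 ≤
    (((B.filter fun b : Finset ι ↦ (b : Set ι) ⊆ H).card : ℕ) : ℝ)}
  -- With at least half the mean present and fewer than a quarter of it deleted, at least a quarter
  -- remains.
  have hsub : Aᶜ ⊆ A1 ∪ A2 := by
    intro H hH
    by_contra hcon
    simp only [Set.mem_union, not_or, A1, A2, Set.mem_ofPred_eq, not_lt, not_le] at hcon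
    obtain ⟨G, hGF, hGH, hGB, hcard⟩ := exists_subset_card_le_card_add_card_filter_subset H F B hne
    refine hH ⟨G, hGF, hGH, hGB, ?_⟩
    have : (((F.filter (· ∈ H)).card : ℕ) : ℝ) ≤ G.card +
        (((B.filter fun b : Finset ι ↦ (b : Set ι) ⊆ H).card : ℕ) : ℝ) := by
      exact_mod_cast hcard
    linarith [hcon.1, hcon.2]
  have h3 : μ.real Aᶜ ≤ μ.real A1 + μ.real A2 :=
    (measureReal_mono hsub).trans (measureReal_union_le _ _)
  have h4 : μ.real Aᶜ = 1 - μ.real A := probReal_compl_eq_one_sub MeasurableSet.of_discrete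
  have h5 : μ.real A2 ≤ 4 * (∑ b ∈ B, (p : ℝ) ^ b.card) / (F.card * (p : ℝ)) := by
    rw [le_div_iff₀ hpos]
    linarith
  have h6 : 1 - μ.real A ≤ 4 / (F.card * (p : ℝ)) +
      4 * (∑ b ∈ B, (p : ℝ) ^ b.card) / (F.card * (p : ℝ)) :=
    h4 ▸ h3.trans (add_le_add h1 h5)
  linarith

open MeasureTheory ProbabilityTheory in
/-- First moment bound for containing a member of a family of `m`-element sets. -/
theorem setBernoulli_real_exists_superset_le {ι : Type*} [Finite ι] {u : Set ι}
    (p : unitInterval) (B : Finset (Finset ι)) (m : ℕ) (hB : ∀ b ∈ B, (b : Set ι) ⊆ u)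
    (hm : ∀ b ∈ B, b.card = m) :
    (setBernoulli u p).real {H | ∃ b ∈ B, (b : Set ι) ⊆ H} ≤ B.card * (p : ℝ) ^ m := by
  have h : {H : Set ι | ∃ b ∈ B, (b : Set ι) ⊆ H} = ⋃ b ∈ B, {H : Set ι | (b : Set ι) ⊆ H} := by
    ext H; simp
  rw [h]
  refine (measureReal_biUnion_finset_le _ _).trans ?_
  rw [Finset.sum_congr rfl fun b hb ↦ (setBernoulli_real_superset p b (hB b hb)).trans
    (by rw [hm b hb])]
  simp

/-! ### Hypergraphs of girth larger than 3. -/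

theorem bergeGirth_anti {V : Type*} {G H : Set (Finset V)} (h : G ⊆ H) :
    bergeGirth H ≤ bergeGirth G := by
  refine le_iInf₂ fun ℓ hℓ ↦ iInf₂_le ℓ ?_
  obtain ⟨h2, v, e, hv, he, hve⟩ := hℓ
  exact ⟨h2, v, e, hv, he, fun i ↦ ⟨h (hve i).1, (hve i).2⟩⟩

theorem three_lt_bergeGirth_iff {V : Type*} {G : Set (Finset V)} :
    3 < bergeGirth G ↔ ¬ HasBergeCycle G 2 ∧ ¬ HasBergeCycle G 3 := by
  constructor
  · intro h
    constructor
    · intro hc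
      have h2 : bergeGirth G ≤ (2 : ℕ) := iInf₂_le 2 ⟨le_rfl, hc⟩
      exact absurd (h.trans_le h2) (by decide)
    · intro hc
      have h2 : bergeGirth G ≤ (3 : ℕ) := iInf₂_le 3 ⟨by norm_num, hc⟩
      exact absurd (h.trans_le h2) (by decide)
  · rintro ⟨h2, h3⟩
    have h4 : ((4 : ℕ) : ℕ∞) ≤ bergeGirth G := by
      refine le_iInf₂ fun ℓ hℓ ↦ ?_
      obtain ⟨hl, hc⟩ := hℓ
      rw [Nat.cast_le]
      by_contra hlt
      interval_cases ℓ
      exacts [h2 hc, h3 hc]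
    exact lt_of_lt_of_le (by decide) h4

/-- Two edges of a hypergraph of girth larger than `2` that share two vertices coincide. -/
theorem eq_of_not_hasBergeCycle_two {V : Type*} {G : Set (Finset V)} (h : ¬ HasBergeCycle G 2)
    {e f : Finset V} (he : e ∈ G) (hf : f ∈ G) {x y : V} (hxy : x ≠ y) (hxe : x ∈ e) (hye : y ∈ e)
    (hxf : x ∈ f) (hyf : y ∈ f) : e = f := by
  by_contra hef
  refine h ⟨![x, y], ![e, f], ?_, ?_, ?_⟩
  · intro i j hij
    fin_cases i <;> fin_cases j <;> simp_all
  · intro i j hij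
    fin_cases i <;> fin_cases j <;> simp_all
  · intro i
    fin_cases i
    · exact ⟨he, hxe, hye⟩
    · exact ⟨hf, hyf, hxf⟩

/-- In a hypergraph of girth larger than `3` three pairwise adjacent vertices lie in one edge. -/
theorem mem_of_triangle {V : Type*} {G : Set (Finset V)} (h2 : ¬ HasBergeCycle G 2)
    (h3 : ¬ HasBergeCycle G 3) {e f g : Finset V} (he : e ∈ G) (hf : f ∈ G) (hg : g ∈ G)
    {x y z : V} (hxy : x ≠ y) (hyz : y ≠ z) (hzx : z ≠ x) (hxe : x ∈ e) (hye : y ∈ e)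
    (hyf : y ∈ f) (hzf : z ∈ f) (hzg : z ∈ g) (hxg : x ∈ g) : z ∈ e := by
  by_cases hef : e = f
  · exact hef ▸ hzf
  by_cases heg : e = g
  · exact heg ▸ hzg
  by_cases hfg : f = g
  · have : e = f := eq_of_not_hasBergeCycle_two h2 he hf hxy hxe hye (hfg ▸ hxg) hyf
    exact absurd this hef
  exfalso
  refine h3 ⟨![x, y, z], ![e, f, g], ?_, ?_, ?_⟩
  · intro i j hij
    fin_cases i <;> fin_cases j <;> simp_all
  · intro i j hij
    fin_cases i <;> fin_cases j <;> simp_all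
  · intro i
    fin_cases i
    · exact ⟨he, hxe, hye⟩
    · exact ⟨hf, hyf, hzf⟩
    · exact ⟨hg, hzg, hxg⟩

/-! ### Encoding by graphs and the first moment. -/

/-- The pairs inside `e` that meet `{a, b}`. -/
def pairsThrough {V : Type*} [DecidableEq V] (a b : V) (e : Finset V) : Finset (Finset V) :=
  (e.erase a).image (fun w ↦ {a, w}) ∪ ((e.erase a).erase b).image (fun w ↦ {b, w})

section pairsThrough

variable {V : Type*} [DecidableEq V] {a b : V} {e : Finset V}

theorem pairsThrough_subset_powersetCard (ha : a ∈ e) (hb : b ∈ e) :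
    pairsThrough a b e ⊆ e.powersetCard 2 := by
  intro s hs
  simp only [pairsThrough, Finset.mem_union, Finset.mem_image, Finset.mem_erase] at hs
  rw [Finset.mem_powersetCard]
  rcases hs with ⟨w, ⟨hwa, hw⟩, rfl⟩ | ⟨w, ⟨hwb, hwa, hw⟩, rfl⟩
  · exact ⟨by simp [Finset.insert_subset_iff, ha, hw], Finset.card_pair hwa.symm⟩
  · exact ⟨by simp [Finset.insert_subset_iff, hb, hw], Finset.card_pair hwb.symm⟩

/-- There are `#e - 1` pairs at `a` and `#e - 2` pairs at `b` that avoid `a`; erasing `a` from the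
second family keeps `{a, b}` from being counted twice. -/
theorem card_pairsThrough (ha : a ∈ e) (hb : b ∈ e) (hab : a ≠ b) :
    (pairsThrough a b e).card = 2 * e.card - 3 := by
  have hinj : ∀ c : V, ∀ s : Finset V, c ∉ s → Set.InjOn (fun w ↦ ({c, w} : Finset V)) s := by
    intro c s hc w hw w' hw' h
    have : w ∈ ({c, w'} : Finset V) := by
      simp only at h
      rw [← h]; simp
    simp only [Finset.mem_insert, Finset.mem_singleton] at this
    rcases this with rfl | h
    · exact absurd hw hc
    · exact h
  have hbe : b ∈ e.erase a := Finset.mem_erase.2 ⟨hab.symm, hb⟩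
  have h1 : (e.erase a).card = e.card - 1 := Finset.card_erase_of_mem ha
  have h2 : ((e.erase a).erase b).card = e.card - 1 - 1 := by
    rw [Finset.card_erase_of_mem hbe, h1]
  have hpos : 0 < (e.erase a).card := Finset.card_pos.2 ⟨b, hbe⟩
  rw [pairsThrough, Finset.card_union_of_disjoint, Finset.card_image_of_injOn,
    Finset.card_image_of_injOn, h1, h2]
  · omega
  · exact hinj b _ (by simp)
  · exact hinj a _ (by simp)
  · rw [Finset.disjoint_left]
    intro s hs hs'
    simp only [Finset.mem_image, Finset.mem_erase] at hs hs'
    obtain ⟨w, -, rfl⟩ := hs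
    obtain ⟨w', ⟨-, hwa, -⟩, h⟩ := hs'
    have : a ∈ ({b, w'} : Finset V) := by rw [h]; simp
    simp only [Finset.mem_insert, Finset.mem_singleton] at this
    rcases this with h | h
    exacts [hab h, hwa h.symm]

end pairsThrough

/-- The number of `r`-graphs with `m` edges and girth larger than `3` on `V` is at most the number
of graphs with `(2 * r - 3) * m` edges on `V`. -/
theorem card_filter_three_lt_bergeGirth_le {V : Type*} [Fintype V] [DecidableEq V] {r : ℕ}
    (hr : 2 ≤ r) (m : ℕ) :
    (open scoped Classical in (((Finset.univ : Finset V).powersetCard r).powersetCard m).filter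
      fun G : Finset (Finset V) ↦ 3 < bergeGirth (G : Set (Finset V))).card ≤
      ((Fintype.card V).choose 2).choose ((2 * r - 3) * m) := by
  classical
  have hex : ∀ e : Finset V, e.card = r → ∃ P, ∃ a ∈ e, ∃ b ∈ e, a ≠ b ∧
      P = pairsThrough a b e := by
    intro e he
    obtain ⟨a, ha, b, hb, hab⟩ := Finset.one_lt_card.1 (show 1 < e.card by omega)
    exact ⟨_, a, ha, b, hb, hab, rfl⟩
  choose! P hP using hex
  have hPsub : ∀ e : Finset V, e.card = r → P e ⊆ e.powersetCard 2 := by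
    intro e he
    obtain ⟨a, ha, b, hb, -, h⟩ := hP e he
    exact h ▸ pairsThrough_subset_powersetCard ha hb
  have hPcard : ∀ e : Finset V, e.card = r → (P e).card = 2 * r - 3 := by
    intro e he
    obtain ⟨a, ha, b, hb, hab, h⟩ := hP e he
    rw [h, card_pairsThrough ha hb hab, he]
  have hM : ((Fintype.card V).choose 2).choose ((2 * r - 3) * m) =
      (((Finset.univ : Finset V).powersetCard 2).powersetCard ((2 * r - 3) * m)).card := by
    simp
  rw [hM]
  have hadj : ∀ G : Finset (Finset V), (∀ e ∈ G, e.card = r) → ∀ x w : V,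
      ({x, w} : Finset V) ∈ G.biUnion P → ∃ e ∈ G, x ∈ e ∧ w ∈ e := by
    intro G hG x w h
    obtain ⟨e, he, hs⟩ := Finset.mem_biUnion.1 h
    have := (Finset.mem_powersetCard.1 (hPsub e (hG e he) hs)).1
    exact ⟨e, he, this (by simp), this (by simp)⟩
  -- Recovery in one direction, with girth needed only for the larger side; injectivity follows by
  -- symmetry.
  have hle : ∀ G G' : Finset (Finset V), (∀ e ∈ G, e.card = r) → (∀ e ∈ G', e.card = r) →
      3 < bergeGirth (G' : Set (Finset V)) → G.biUnion P = G'.biUnion P → G ⊆ G' := by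
    intro G G' hG hG' hg h e he
    obtain ⟨h2, h3⟩ := three_lt_bergeGirth_iff.1 hg
    obtain ⟨a, ha, b, hb, hab, hPe⟩ := hP e (hG e he)
    have hmem : ∀ s ∈ pairsThrough a b e, s ∈ G'.biUnion P := by
      intro s hs
      rw [← h]
      exact Finset.mem_biUnion.2 ⟨e, he, hPe ▸ hs⟩
    have hap : ∀ w ∈ e, w ≠ a → ∃ f ∈ G', a ∈ f ∧ w ∈ f := fun w hw hwa ↦
      hadj G' hG' a w (hmem _ (Finset.mem_union_left _
        (Finset.mem_image_of_mem (fun w ↦ ({a, w} : Finset V)) (Finset.mem_erase.2 ⟨hwa, hw⟩))))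
    have hbp : ∀ w ∈ e, w ≠ a → w ≠ b → ∃ f ∈ G', b ∈ f ∧ w ∈ f := fun w hw hwa hwb ↦
      hadj G' hG' b w (hmem _ (Finset.mem_union_right _
        (Finset.mem_image_of_mem (fun w ↦ ({b, w} : Finset V))
          (Finset.mem_erase.2 ⟨hwb, Finset.mem_erase.2 ⟨hwa, hw⟩⟩))))
    obtain ⟨f, hf, haf, hbf⟩ := hap b hb hab.symm
    -- Any further `w` in `e` is joined to both `a` and `b` in `G'`, so the triangle `a, b, w` puts
    -- `w` into the edge `f` through `a` and `b`.
    have hef : e ⊆ f := by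
      intro w hw
      by_cases hwa : w = a
      · exact hwa ▸ haf
      by_cases hwb : w = b
      · exact hwb ▸ hbf
      obtain ⟨f1, hf1, haf1, hwf1⟩ := hap w hw hwa
      obtain ⟨f2, hf2, hbf2, hwf2⟩ := hbp w hw hwa hwb
      exact mem_of_triangle h2 h3 hf hf2 hf1 hab (Ne.symm hwb) hwa haf hbf hbf2 hwf2 hwf1 haf1
    rw [Finset.eq_of_subset_of_card_le hef (by rw [hG e he, hG' f hf])]
    exact hf
  refine Finset.card_le_card_of_injOn (fun G ↦ G.biUnion P) ?_ ?_
  · intro G hG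
    simp only [Finset.coe_filter, Finset.mem_powersetCard, Set.mem_ofPred_eq] at hG
    obtain ⟨⟨hGr, hGm⟩, hg⟩ := hG
    have hGr' : ∀ e ∈ G, e.card = r := fun e he ↦ (Finset.mem_powersetCard.1 (hGr he)).2
    obtain ⟨h2, h3⟩ := three_lt_bergeGirth_iff.1 hg
    rw [Finset.mem_coe, Finset.mem_powersetCard]
    constructor
    · intro s hs
      obtain ⟨e, he, hs⟩ := Finset.mem_biUnion.1 hs
      have := Finset.mem_powersetCard.1 (hPsub e (hGr' e he) hs)
      exact Finset.mem_powersetCard.2 ⟨Finset.subset_univ _, this.2⟩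
    · rw [Finset.card_biUnion, Finset.sum_congr rfl fun e he ↦ hPcard e (hGr' e he)]
      · rw [Finset.sum_const, hGm, smul_eq_mul, mul_comm]
      · intro e he f hf hef
        rw [Function.onFun, Finset.disjoint_left]
        intro s hse hsf
        have h1 := Finset.mem_powersetCard.1 (hPsub e (hGr' e he) hse)
        have h1' := Finset.mem_powersetCard.1 (hPsub f (hGr' f hf) hsf)
        obtain ⟨x, hx, y, hy, hxy⟩ := Finset.one_lt_card.1 (show 1 < s.card by omega)
        exact hef (eq_of_not_hasBergeCycle_two h2 he hf hxy (h1.1 hx) (h1.1 hy) (h1'.1 hx)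
          (h1'.1 hy))
  · intro G hG G' hG' h
    simp only [Finset.coe_filter, Finset.mem_powersetCard, Set.mem_ofPred_eq] at hG hG'
    have hr1 : ∀ e ∈ G, e.card = r := fun e he ↦ (Finset.mem_powersetCard.1 (hG.1.1 he)).2
    have hr2 : ∀ e ∈ G', e.card = r := fun e he ↦ (Finset.mem_powersetCard.1 (hG'.1.1 he)).2
    exact (hle G G' hr1 hr2 hG'.2 h).antisymm (hle G' G hr2 hr1 hG.2 h.symm)

open MeasureTheory ProbabilityTheory in
/-- First moment bound for `exGirth H 3` of a random `r`-graph `H`. -/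
theorem randomRGraph_real_le_exGirth_le {r : ℕ} (hr : 2 ≤ r) (n m : ℕ) (p : unitInterval) :
    (randomRGraph r n p).real {H | m ≤ exGirth H 3} ≤
      ((n.choose 2).choose ((2 * r - 3) * m) : ℕ) * (p : ℝ) ^ m := by
  classical
  set u : Set (Finset (Fin n)) := {e | e.card = r}
  set B := (((Finset.univ : Finset (Fin n)).powersetCard r).powersetCard m).filter
      fun G : Finset (Finset (Fin n)) ↦ 3 < bergeGirth (G : Set (Finset (Fin n)))
  have hB : ∀ b ∈ B, (b : Set (Finset (Fin n))) ⊆ u ∧ b.card = m := by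
    intro b hb
    have hb' := Finset.mem_powersetCard.1 (Finset.mem_filter.1 hb).1
    exact ⟨fun e he ↦ (Finset.mem_powersetCard.1 (hb'.1 he)).2, hb'.2⟩
  have h1 : (randomRGraph r n p).real {H | m ≤ exGirth H 3} ≤
      (setBernoulli u p).real {H | ∃ b ∈ B, (b : Set (Finset (Fin n))) ⊆ H} := by
    -- The law is carried by the subsets of `u`; without this restriction `H` could contain edges of
    -- the wrong size.
    rw [measureReal_def, measureReal_def, randomRGraph, setBernoulli_apply_eq_apply_subsets]
    refine ENNReal.toReal_mono (measure_ne_top _ _) (measure_mono ?_)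
    rintro H ⟨hH, hHu⟩
    obtain ⟨G, hGH, hg, hcard⟩ := (isGreatest_exGirth H 3).1
    obtain ⟨b, hbG, hbm⟩ := Finset.exists_subset_card_eq (s := G.toFinite.toFinset) (n := m) (by
      rw [← Set.ncard_eq_toFinset_card, hcard]; exact hH)
    have hbG' : (b : Set (Finset (Fin n))) ⊆ G := by
      intro x hx
      simpa using hbG hx
    refine ⟨b, Finset.mem_filter.2 ⟨Finset.mem_powersetCard.2 ⟨fun e he ↦ ?_, hbm⟩, ?_⟩,
      hbG'.trans hGH⟩
    · exact Finset.mem_powersetCard.2 ⟨Finset.subset_univ _, hHu (hGH (hbG' he))⟩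
    · exact lt_of_lt_of_le hg (bergeGirth_anti hbG')
  refine h1.trans ((setBernoulli_real_exists_superset_le p B m (fun b hb ↦ (hB b hb).1)
    (fun b hb ↦ (hB b hb).2)).trans ?_)
  have := card_filter_three_lt_bergeGirth_le (V := Fin n) hr m
  rw [Fintype.card_fin] at this
  have hp := p.2.1
  gcongr

/-- A binomial tail estimate. -/
theorem choose_mul_pow_le_half_pow {n K : ℕ} {θ : ℝ} (hθ : 0 ≤ θ) (hK : 3 * (θ * n ^ 2) ≤ K) :
    (((n.choose 2).choose K : ℕ) : ℝ) * θ ^ K ≤ (1 / 2) ^ K := by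
  have hM : ((n.choose 2 : ℕ) : ℝ) * θ ≤ K / 6 := by
    have : ((n.choose 2 : ℕ) : ℝ) ≤ n ^ 2 / 2 := by
      simpa using Nat.choose_le_pow_div (α := ℝ) 2 n
    nlinarith
  have hf : (0 : ℝ) < (K.factorial : ℝ) := by exact_mod_cast K.factorial_pos
  calc (((n.choose 2).choose K : ℕ) : ℝ) * θ ^ K
      ≤ (((n.choose 2 : ℕ) : ℝ) ^ K / K.factorial) * θ ^ K := by
        gcongr
        exact Nat.choose_le_pow_div (α := ℝ) K _
    _ = (((n.choose 2 : ℕ) : ℝ) * θ) ^ K / K.factorial := by rw [mul_pow]; ring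
    _ ≤ (K / 6) ^ K / K.factorial := by gcongr
    _ = (1 / 6) ^ K * (K ^ K / K.factorial) := by rw [div_pow, one_div_pow]; ring
    -- `K ^ K / K! ≤ e ^ K` and `e < 3`.
    _ ≤ (1 / 6) ^ K * 3 ^ K := by
        gcongr
        refine (Real.pow_div_factorial_le_exp (K : ℝ) (by positivity) K).trans ?_
        rw [← Real.exp_one_pow]
        gcongr
        exact Real.exp_one_lt_three.le
    _ = (1 / 2) ^ K := by rw [← mul_pow]; norm_num

/-! ### Behrend-type construction. -/

/-- A family `J` of transversals of `r` copies of `U`, seen as an `r`-partite `r`-graph, has no two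
edges sharing two vertices and no Berge triangle. -/
structure IsLinearTriangleFree {r : ℕ} {U : Type*} (J : Finset (Fin r → U)) : Prop where
  linear : ∀ g ∈ J, ∀ g' ∈ J, ∀ i j, i ≠ j → g i = g' i → g j = g' j → g = g'
  triangle : ∀ g₁ ∈ J, ∀ g₂ ∈ J, ∀ g₃ ∈ J, ∀ i j k, i ≠ j → j ≠ k → k ≠ i →
    g₁ i = g₃ i → g₁ j = g₂ j → g₂ k = g₃ k → g₁ = g₂

/-- Two integer points on a sphere around the origin, some proper affine combination of which lies on
the same sphere, coincide. -/
theorem eq_of_affine_combination_on_sphere {D : ℕ} {a b c : Fin D → ℤ} {R α β : ℤ}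
    (ha : ∑ d, a d ^ 2 = R) (hb : ∑ d, b d ^ 2 = R) (hc : ∑ d, c d ^ 2 = R)
    (hα : α ≠ 0) (hβ : β ≠ 0) (h : ∀ d, α * a d + β * b d = (α + β) * c d) : a = b := by
  have h1 : ∑ d, (α * a d + β * b d) ^ 2 = (α + β) ^ 2 * R := by
    rw [← hc, Finset.mul_sum]
    exact Finset.sum_congr rfl fun d _ ↦ by rw [h d]; ring
  -- Stewart's identity. On a common sphere everything cancels except `α β |a - b| ^ 2`, so no sign
  -- condition on `α` and `β` is needed.
  have h2 : ∑ d, (α * a d + β * b d) ^ 2 + α * β * ∑ d, (a d - b d) ^ 2 =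
      (α ^ 2 + α * β) * ∑ d, a d ^ 2 + (β ^ 2 + α * β) * ∑ d, b d ^ 2 := by
    simp only [Finset.mul_sum, ← Finset.sum_add_distrib]
    exact Finset.sum_congr rfl fun d _ ↦ by ring
  have h3 : α * β * ∑ d, (a d - b d) ^ 2 = 0 := by
    rw [h1, ha, hb] at h2
    linarith
  have h4 : ∑ d, (a d - b d) ^ 2 = 0 := by
    simpa [hα, hβ] using h3
  rw [Finset.sum_eq_zero_iff_of_nonneg fun d _ ↦ sq_nonneg _] at h4
  funext d
  have := h4 d (Finset.mem_univ d)
  exact sub_eq_zero.1 (by simpa using this)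

/-- Some sphere around the origin contains many points of the box `[0, q)^D`. -/
theorem exists_dense_sphere (D q : ℕ) :
    ∃ R, q ^ D ≤ ((Finset.univ : Finset (Fin D → Fin q)).filter
      fun a ↦ ∑ d, (a d : ℕ) ^ 2 = R).card * (D * q ^ 2 + 1) := by
  have hmaps : ∀ a ∈ (Finset.univ : Finset (Fin D → Fin q)),
      ∑ d, (a d : ℕ) ^ 2 ∈ Finset.range (D * q ^ 2 + 1) := by
    intro a _
    rw [Finset.mem_range, Nat.lt_succ_iff]
    calc ∑ d, (a d : ℕ) ^ 2 ≤ ∑ _d : Fin D, q ^ 2 := by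
          gcongr with d
          exact (a d).2.le
      _ = D * q ^ 2 := by simp
  -- Pigeonhole: the squared norm takes at most `D q ^ 2 + 1` values on the box, and the most
  -- popular one is chosen.
  obtain ⟨R, -, hR⟩ := Finset.exists_max_image (Finset.range (D * q ^ 2 + 1))
    (fun R ↦ ((Finset.univ : Finset (Fin D → Fin q)).filter
      fun a ↦ ∑ d, (a d : ℕ) ^ 2 = R).card) ⟨0, by simp⟩
  refine ⟨R, ?_⟩
  have := Finset.card_le_mul_card_image_of_maps_to hmaps _ hR
  simpa using this

/-- The line with base point `x` and direction `a`, seen as a transversal of `r` copies of the box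
`[0, r * q)^D`. -/
def boxLine {r D q : ℕ} (x a : Fin D → Fin q) (i : Fin r) (d : Fin D) : Fin (r * q) :=
  ⟨x d + i * a d, by
    have h1 := (x d).2
    have h2 : (i : ℕ) * a d ≤ (r - 1) * q := Nat.mul_le_mul (by omega) (a d).2.le
    have h3 : (r - 1) * q + q = r * q := by
      rw [← Nat.succ_mul, Nat.succ_eq_add_one, Nat.sub_add_cancel (by have := i.2; omega)]
    omega⟩

theorem boxLine_eq_iff {r D q : ℕ} {x a x' a' : Fin D → Fin q} {i : Fin r} :
    boxLine x a i = boxLine x' a' i ↔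
      ∀ d, (x d : ℤ) + i * a d = (x' d : ℤ) + i * a' d := by
  simp only [funext_iff, boxLine, Fin.mk.injEq]
  exact forall_congr' fun d ↦ by exact_mod_cast Iff.rfl

/-- Two points of a line at known distinct times determine its direction, hence its base point. -/
theorem boxLine_injective_pair {r D q : ℕ} {x a x' a' : Fin D → Fin q} {i j : Fin r} (hij : i ≠ j)
    (hi : boxLine x a i = boxLine x' a' i) (hj : boxLine x a j = boxLine x' a' j) :
    x = x' ∧ a = a' := by
  rw [boxLine_eq_iff] at hi hj
  have hij' : ((i : ℕ) : ℤ) - (j : ℕ) ≠ 0 := by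
    rw [sub_ne_zero]
    exact_mod_cast fun h ↦ hij (Fin.ext h)
  have ha : ∀ d, ((a d : ℕ) : ℤ) = (a' d : ℕ) := by
    intro d
    have : (((i : ℕ) : ℤ) - (j : ℕ)) * ((a d : ℕ) - (a' d : ℕ)) = 0 := by
      linear_combination hi d - hj d
    exact sub_eq_zero.1 ((mul_eq_zero.1 this).resolve_left hij')
  have hx : ∀ d, ((x d : ℕ) : ℤ) = (x' d : ℕ) := by
    intro d
    have := hi d
    rw [ha d] at this
    linarith
  exact ⟨funext fun d ↦ Fin.ext (by exact_mod_cast hx d),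
    funext fun d ↦ Fin.ext (by exact_mod_cast ha d)⟩

/-- A Behrend-type construction of dense `r`-partite `r`-graphs of girth larger than `3`. -/
theorem exists_isLinearTriangleFree {r : ℕ} (hr : 2 ≤ r) (D q : ℕ) :
    ∃ J : Finset (Fin r → Fin D → Fin (r * q)), IsLinearTriangleFree J ∧
      q ^ D * q ^ D ≤ J.card * (D * q ^ 2 + 1) := by
  classical
  obtain ⟨R, hR⟩ := exists_dense_sphere D q
  set S := (Finset.univ : Finset (Fin D → Fin q)).filter fun a ↦ ∑ d, (a d : ℕ) ^ 2 = R
  have hS : ∀ a ∈ S, ∑ d, (((a d : ℕ) : ℤ)) ^ 2 = R := by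
    intro a ha
    exact_mod_cast (Finset.mem_filter.1 ha).2
  refine ⟨((Finset.univ : Finset (Fin D → Fin q)) ×ˢ S).image fun xa ↦ boxLine xa.1 xa.2,
    ⟨?_, ?_⟩, ?_⟩
  · simp only [Finset.mem_image, Finset.mem_product, Finset.mem_univ, true_and, Prod.exists]
    rintro _ ⟨x, a, -, rfl⟩ _ ⟨x', a', -, rfl⟩ i j hij hi hj
    obtain ⟨rfl, rfl⟩ := boxLine_injective_pair hij hi hj
    rfl
  · simp only [Finset.mem_image, Finset.mem_product, Finset.mem_univ, true_and, Prod.exists]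
    rintro _ ⟨x, a, ha, rfl⟩ _ ⟨x', a', ha', rfl⟩ _ ⟨x'', a'', ha'', rfl⟩ i j k hij hjk hki h13 h12 h23
    rw [boxLine_eq_iff] at h13 h12 h23
    have hne : ∀ i j : Fin r, i ≠ j → ((i : ℕ) : ℤ) - (j : ℕ) ≠ 0 := by
      intro i j hij
      rw [sub_ne_zero]
      exact_mod_cast fun h ↦ hij (Fin.ext h)
    -- Eliminating the base points leaves `(j - i) a + (k - j) a' = (k - i) a''`, an affine relation
    -- between three points of one sphere.
    have haa : (fun d ↦ ((a d : ℕ) : ℤ)) = fun d ↦ ((a' d : ℕ) : ℤ) := by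
      refine eq_of_affine_combination_on_sphere (hS a ha) (hS a' ha') (hS a'' ha'')
        (hne j i hij.symm) (hne k j hjk.symm) fun d ↦ ?_
      linear_combination h12 d - h13 d + h23 d
    have haa' : a = a' := funext fun d ↦ Fin.ext (by exact_mod_cast congrFun haa d)
    subst haa'
    have hxx : x = x' := funext fun d ↦ Fin.ext (by
      have := h12 d
      simp only [add_left_inj] at this
      exact_mod_cast this)
    rw [hxx]
  · rw [Finset.card_image_of_injOn, Finset.card_product, mul_assoc]
    · simpa using Nat.mul_le_mul_left (q ^ D) hR
    · rintro ⟨x, a⟩ - ⟨x', a'⟩ - h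
      have hij : (⟨0, by omega⟩ : Fin r) ≠ ⟨1, by omega⟩ := by simp
      obtain ⟨rfl, rfl⟩ := boxLine_injective_pair hij (congrFun h _) (congrFun h _)
      rfl

/-! ### Blow-ups and their short Berge cycles. -/

section blowup

variable {r s : ℕ} {U V : Type*} [DecidableEq V] (φ : Fin r × U × Fin s ↪ V)

/-- The edge over `g` in the blow-up in which each vertex is replaced by `s` copies, with the copies
selected by `c`. -/
def blowupEdge (g : Fin r → U) (c : Fin r → Fin s) : Finset V :=
  Finset.univ.image fun i ↦ φ (i, g i, c i)

variable {φ}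

theorem card_blowupEdge (g : Fin r → U) (c : Fin r → Fin s) : (blowupEdge φ g c).card = r := by
  rw [blowupEdge, Finset.card_image_of_injective, Finset.card_univ, Fintype.card_fin]
  intro i j h
  exact congrArg Prod.fst (φ.injective h)

/-- The parts are disjoint, so a common vertex sits at the same index in both edges. This turns
incidences in the blow-up into coordinate equalities. -/
theorem exists_index_of_mem_blowupEdge {g g' : Fin r → U} {c c' : Fin r → Fin s} {x : V}
    (h : x ∈ blowupEdge φ g c) (h' : x ∈ blowupEdge φ g' c') :
    ∃ i, φ (i, g i, c i) = x ∧ g i = g' i ∧ c i = c' i := by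
  simp only [blowupEdge, Finset.mem_image, Finset.mem_univ, true_and] at h h'
  obtain ⟨i, hi⟩ := h
  obtain ⟨j, hj⟩ := h'
  have := φ.injective (hi.trans hj.symm)
  simp only [Prod.mk.injEq] at this
  obtain ⟨rfl, h1, h2⟩ := this
  exact ⟨i, hi, h1, h2⟩

theorem blowupEdge_injective {g g' : Fin r → U} {c c' : Fin r → Fin s}
    (h : blowupEdge φ g c = blowupEdge φ g' c') : g = g' ∧ c = c' := by
  have : ∀ i, g i = g' i ∧ c i = c' i := by
    intro i
    have hi : φ (i, g i, c i) ∈ blowupEdge φ g c := Finset.mem_image_of_mem _ (Finset.mem_univ i)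
    obtain ⟨j, hj, h1, h2⟩ := exists_index_of_mem_blowupEdge hi (h ▸ hi)
    have : j = i := congrArg Prod.fst (φ.injective hj)
    exact this ▸ ⟨h1, h2⟩
  exact ⟨funext fun i ↦ (this i).1, funext fun i ↦ (this i).2⟩

variable (φ) in
/-- The blow-up of the `r`-partite `r`-graph `J`. -/
def blowup (J : Finset (Fin r → U)) : Finset (Finset V) :=
  (J ×ˢ Finset.univ).image fun gc ↦ blowupEdge φ gc.1 gc.2

theorem mem_blowup {J : Finset (Fin r → U)} {e : Finset V} :
    e ∈ blowup φ J ↔ ∃ g ∈ J, ∃ c, blowupEdge φ g c = e := by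
  simp only [blowup, Finset.mem_image, Finset.mem_product, Finset.mem_univ, and_true, Prod.exists]
  exact ⟨fun ⟨g, c, hg, h⟩ ↦ ⟨g, hg, c, h⟩, fun ⟨g, hg, c, h⟩ ↦ ⟨g, c, hg, h⟩⟩

theorem card_blowup (J : Finset (Fin r → U)) : (blowup φ J).card = J.card * s ^ r := by
  rw [blowup, Finset.card_image_of_injective, Finset.card_product]
  · simp
  · rintro ⟨g, c⟩ ⟨g', c'⟩ h
    obtain ⟨rfl, rfl⟩ := blowupEdge_injective h
    rfl

/-- The functions that agree with `a` on `T`. -/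
def agreeOn (T : Finset (Fin r)) (a : Fin r → Fin s) : Finset (Fin r → Fin s) :=
  Fintype.piFinset fun l ↦ if l ∈ T then {a l} else Finset.univ

theorem mem_agreeOn {T : Finset (Fin r)} {a c : Fin r → Fin s} :
    c ∈ agreeOn T a ↔ ∀ l ∈ T, c l = a l := by
  simp only [agreeOn, Fintype.mem_piFinset]
  refine forall_congr' fun l ↦ ?_
  split_ifs with h <;> simp [h]

theorem card_agreeOn (T : Finset (Fin r)) (a : Fin r → Fin s) :
    (agreeOn T a).card = s ^ (r - T.card) := by
  rw [agreeOn, Fintype.card_piFinset]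
  have : ∀ l : Fin r, (if l ∈ T then {a l} else (Finset.univ : Finset (Fin s))).card =
      if l ∈ T then 1 else s := by
    intro l
    split_ifs <;> simp
  rw [Finset.prod_congr rfl fun l _ ↦ this l, Finset.prod_ite]
  simp [Finset.filter_not, Finset.card_sdiff]

/-- A Berge `2`-cycle in a blow-up of a linear triangle-free `r`-graph lies over a single edge. -/
theorem exists_of_hasBergeCycle_two {J : Finset (Fin r → U)} (hJ : IsLinearTriangleFree J)
    {b : Finset (Finset V)} (hb : b ⊆ blowup φ J) (hcard : b.card = 2)
    (hc : HasBergeCycle (b : Set (Finset V)) 2) :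
    ∃ g ∈ J, ∃ i j, i ≠ j ∧ ∃ c, ∃ c' ∈ agreeOn {i, j} c,
      b = {blowupEdge φ g c, blowupEdge φ g c'} := by
  obtain ⟨v, e, hv, he, hve⟩ := hc
  have hv01 : v 0 ≠ v 1 := fun h ↦ by simpa using hv h
  have he01 : e 0 ≠ e 1 := fun h ↦ by simpa using he h
  obtain ⟨h0, h00, h01⟩ := hve 0
  obtain ⟨h1, h11, h10⟩ := hve 1
  change v 1 ∈ e 0 at h01
  change v 0 ∈ e 1 at h10
  obtain ⟨g, hg, c, hgc⟩ := mem_blowup.1 (hb h0)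
  obtain ⟨g', hg', c', hgc'⟩ := mem_blowup.1 (hb h1)
  have hbe : b = {e 0, e 1} := by
    refine (Finset.eq_of_subset_of_card_le ?_ ?_).symm
    · intro x hx
      simp only [Finset.mem_insert, Finset.mem_singleton] at hx
      rcases hx with rfl | rfl
      exacts [h0, h1]
    · rw [hcard, Finset.card_pair he01]
  rw [← hgc] at h00 h01 hbe
  rw [← hgc'] at h11 h10 hbe
  obtain ⟨i, hi, hgi, hci⟩ := exists_index_of_mem_blowupEdge h00 h10
  obtain ⟨j, hj, hgj, hcj⟩ := exists_index_of_mem_blowupEdge h01 h11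
  have hij : i ≠ j := by
    rintro rfl
    exact hv01 (hi.symm.trans hj)
  obtain rfl := hJ.linear g hg g' hg' i j hij hgi hgj
  refine ⟨g, hg, i, j, hij, c, c', ?_, hbe⟩
  simp [mem_agreeOn, hci, hcj]

/-- A Berge `3`-cycle in a blow-up of a linear triangle-free `r`-graph lies over a single edge. -/
theorem exists_of_hasBergeCycle_three {J : Finset (Fin r → U)} (hJ : IsLinearTriangleFree J)
    {b : Finset (Finset V)} (hb : b ⊆ blowup φ J) (hcard : b.card = 3)
    (hc : HasBergeCycle (b : Set (Finset V)) 3) :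
    ∃ g ∈ J, ∃ i j k, i ≠ j ∧ j ≠ k ∧ k ≠ i ∧ ∃ c, ∃ c' ∈ agreeOn {j} c,
      ∃ c'' ∈ agreeOn {i, k} (Function.update c k (c' k)),
      b = {blowupEdge φ g c, blowupEdge φ g c', blowupEdge φ g c''} := by
  obtain ⟨v, e, hv, he, hve⟩ := hc
  have hv01 : v 0 ≠ v 1 := fun h ↦ by simpa using hv h
  have hv12 : v 1 ≠ v 2 := fun h ↦ by simpa using hv h
  have hv20 : v 2 ≠ v 0 := fun h ↦ by simpa using hv h
  have he01 : e 0 ≠ e 1 := fun h ↦ by simpa using he h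
  have he12 : e 1 ≠ e 2 := fun h ↦ by simpa using he h
  have he02 : e 0 ≠ e 2 := fun h ↦ by simpa using he h
  obtain ⟨h0, h00, h01⟩ := hve 0
  obtain ⟨h1, h11, h12⟩ := hve 1
  obtain ⟨h2, h22, h20⟩ := hve 2
  change v 1 ∈ e 0 at h01
  change v 2 ∈ e 1 at h12
  change v 0 ∈ e 2 at h20
  obtain ⟨g, hg, c, hgc⟩ := mem_blowup.1 (hb h0)
  obtain ⟨g', hg', c', hgc'⟩ := mem_blowup.1 (hb h1)
  obtain ⟨g'', hg'', c'', hgc''⟩ := mem_blowup.1 (hb h2)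
  have hbe : b = {e 0, e 1, e 2} := by
    refine (Finset.eq_of_subset_of_card_le ?_ ?_).symm
    · intro x hx
      simp only [Finset.mem_insert, Finset.mem_singleton] at hx
      rcases hx with rfl | rfl | rfl
      exacts [h0, h1, h2]
    · rw [hcard, Finset.card_eq_three.2 ⟨e 0, e 1, e 2, he01, he02, he12, rfl⟩]
  rw [← hgc] at h00 h01 hbe
  rw [← hgc'] at h11 h12 hbe
  rw [← hgc''] at h22 h20 hbe
  obtain ⟨i, hi, hgi, hci⟩ := exists_index_of_mem_blowupEdge h00 h20
  obtain ⟨j, hj, hgj, hcj⟩ := exists_index_of_mem_blowupEdge h01 h11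
  obtain ⟨k, hk, hgk, hck⟩ := exists_index_of_mem_blowupEdge h12 h22
  have hij : i ≠ j := by
    rintro rfl
    exact hv01 (hi.symm.trans hj)
  have hjk : j ≠ k := by
    rintro rfl
    rw [← hj, ← hk, hgj, hcj] at hv12
    exact hv12 rfl
  have hki : k ≠ i := by
    rintro rfl
    rw [← hi, ← hk, hgk, hck, hgi, hci] at hv20
    exact hv20 rfl
  -- Once the first two base edges agree, the third shares the coordinates `i` and `k` with them,
  -- and linearity finishes.
  obtain rfl := hJ.triangle g hg g' hg' g'' hg'' i j k hij hjk hki hgi hgj hgk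
  obtain rfl := hJ.linear g hg g'' hg'' i k hki.symm hgi hgk
  refine ⟨g, hg, i, j, k, hij, hjk, hki, c, c', ?_, c'', ?_, hbe⟩
  · simp [mem_agreeOn, hcj]
  · simp [mem_agreeOn, hci, hck, Function.update_of_ne hki.symm]

open scoped Classical in
/-- The sets of `ℓ` edges of `F` that form a Berge `ℓ`-cycle. -/
noncomputable def bergeObstructions (F : Finset (Finset V)) (ℓ : ℕ) : Finset (Finset (Finset V)) :=
  (F.powersetCard ℓ).filter fun b ↦ HasBergeCycle (b : Set (Finset V)) ℓ

theorem mem_bergeObstructions {F : Finset (Finset V)} {ℓ : ℕ} {b : Finset (Finset V)} :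
    b ∈ bergeObstructions F ℓ ↔
      b ⊆ F ∧ b.card = ℓ ∧ HasBergeCycle (b : Set (Finset V)) ℓ := by
  classical
  rw [bergeObstructions, Finset.mem_filter, Finset.mem_powersetCard, and_assoc]

theorem not_hasBergeCycle_of_avoids {F G : Finset (Finset V)} {ℓ : ℕ} (hGF : G ⊆ F)
    (h : ∀ b ∈ bergeObstructions F ℓ, ¬ b ⊆ G) : ¬ HasBergeCycle (G : Set (Finset V)) ℓ := by
  rintro ⟨v, e, hv, he, hve⟩
  have hsub : Finset.univ.image e ⊆ G := by
    intro x hx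
    obtain ⟨i, -, rfl⟩ := Finset.mem_image.1 hx
    exact (hve i).1
  refine h _ (mem_bergeObstructions.2 ⟨hsub.trans hGF, ?_, v, e, hv, he, fun i ↦ ⟨?_, (hve i).2⟩⟩)
    hsub
  · rw [Finset.card_image_of_injective _ he, Finset.card_univ, Fintype.card_fin]
  · simp

theorem card_bergeObstructions_two_le {J : Finset (Fin r → U)} (hJ : IsLinearTriangleFree J) :
    (bergeObstructions (blowup φ J) 2).card ≤ J.card * (r ^ 2 * (s ^ r * s ^ (r - 2))) := by
  classical
  have hsub : bergeObstructions (blowup φ J) 2 ⊆ J.biUnion fun g ↦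
      ((Finset.univ : Finset (Fin r × Fin r)).filter fun t ↦ t.1 ≠ t.2).biUnion fun t ↦
      (Finset.univ : Finset (Fin r → Fin s)).biUnion fun c ↦
      (agreeOn {t.1, t.2} c).image fun c' ↦ {blowupEdge φ g c, blowupEdge φ g c'} := by
    intro b hb
    obtain ⟨hb, hcard, hc⟩ := mem_bergeObstructions.1 hb
    obtain ⟨g, hg, i, j, hij, c, c', hc', rfl⟩ := exists_of_hasBergeCycle_two hJ hb hcard hc
    simp only [Finset.mem_biUnion, Finset.mem_image, Finset.mem_filter, Finset.mem_univ, true_and]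
    exact ⟨g, hg, (i, j), hij, c, c', hc', rfl⟩
  refine (Finset.card_le_card hsub).trans (Finset.card_biUnion_le_card_mul _ _ _ fun g _ ↦ ?_)
  refine (Finset.card_biUnion_le_card_mul _ _ (s ^ r * s ^ (r - 2)) fun t ht ↦ ?_).trans ?_
  · refine (Finset.card_biUnion_le_card_mul _ _ (s ^ (r - 2)) fun c _ ↦ ?_).trans (by simp)
    refine Finset.card_image_le.trans ?_
    rw [card_agreeOn, Finset.card_pair (Finset.mem_filter.1 ht).2]
  · gcongr
    refine (Finset.card_filter_le _ _).trans ?_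
    simp [sq]

/-- Over one base edge, `c` is free, `c'` agrees with it at one index, and `c''` is prescribed at
two indices, by `c` and by `c'`; the factor `r ^ 3` pays for the indices. -/
theorem card_bergeObstructions_three_le {J : Finset (Fin r → U)} (hJ : IsLinearTriangleFree J) :
    (bergeObstructions (blowup φ J) 3).card ≤
      J.card * (r ^ 3 * (s ^ r * (s ^ (r - 1) * s ^ (r - 2)))) := by
  classical
  have hsub : bergeObstructions (blowup φ J) 3 ⊆ J.biUnion fun g ↦
      ((Finset.univ : Finset (Fin r × Fin r × Fin r)).filter fun t ↦ t.2.2 ≠ t.1).biUnion fun t ↦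
      (Finset.univ : Finset (Fin r → Fin s)).biUnion fun c ↦
      (agreeOn {t.2.1} c).biUnion fun c' ↦
      (agreeOn {t.1, t.2.2} (Function.update c t.2.2 (c' t.2.2))).image fun c'' ↦
        {blowupEdge φ g c, blowupEdge φ g c', blowupEdge φ g c''} := by
    intro b hb
    obtain ⟨hb, hcard, hc⟩ := mem_bergeObstructions.1 hb
    obtain ⟨g, hg, i, j, k, hij, hjk, hki, c, c', hc', c'', hc'', rfl⟩ :=
      exists_of_hasBergeCycle_three hJ hb hcard hc
    simp only [Finset.mem_biUnion, Finset.mem_image, Finset.mem_filter, Finset.mem_univ, true_and]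
    exact ⟨g, hg, (i, j, k), hki, c, c', hc', c'', hc'', rfl⟩
  refine (Finset.card_le_card hsub).trans (Finset.card_biUnion_le_card_mul _ _ _ fun g _ ↦ ?_)
  refine (Finset.card_biUnion_le_card_mul _ _ (s ^ r * (s ^ (r - 1) * s ^ (r - 2)))
    fun t ht ↦ ?_).trans ?_
  · refine (Finset.card_biUnion_le_card_mul _ _ (s ^ (r - 1) * s ^ (r - 2))
      fun c _ ↦ ?_).trans (by simp)
    refine (Finset.card_biUnion_le_card_mul _ _ (s ^ (r - 2)) fun c' _ ↦ ?_).trans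
      (by rw [card_agreeOn, Finset.card_singleton])
    refine Finset.card_image_le.trans ?_
    rw [card_agreeOn, Finset.card_pair (Finset.mem_filter.1 ht).2.symm]
  · gcongr
    refine (Finset.card_filter_le _ _).trans ?_
    simp [pow_succ, mul_assoc]

/-- With a single copy per vertex there is one edge over each `g`, but a cycle needs distinct ones.
This serves large `p`, where nothing has to be deleted. -/
theorem bergeObstructions_two_eq_empty {J : Finset (Fin r → U)} (hJ : IsLinearTriangleFree J)
    (hs : s = 1) : bergeObstructions (blowup φ J) 2 = ∅ := by
  subst hs
  refine Finset.eq_empty_of_forall_notMem fun b hb ↦ ?_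
  obtain ⟨hb, hcard, hc⟩ := mem_bergeObstructions.1 hb
  obtain ⟨g, hg, i, j, hij, c, c', hc', rfl⟩ := exists_of_hasBergeCycle_two hJ hb hcard hc
  rw [Subsingleton.elim c' c] at hcard
  simp at hcard

theorem bergeObstructions_three_eq_empty {J : Finset (Fin r → U)} (hJ : IsLinearTriangleFree J)
    (hs : s = 1) : bergeObstructions (blowup φ J) 3 = ∅ := by
  subst hs
  refine Finset.eq_empty_of_forall_notMem fun b hb ↦ ?_
  obtain ⟨hb, hcard, hc⟩ := mem_bergeObstructions.1 hb
  obtain ⟨g, hg, i, j, k, hij, hjk, hki, c, c', hc', c'', hc'', rfl⟩ :=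
    exists_of_hasBergeCycle_three hJ hb hcard hc
  rw [Subsingleton.elim c' c, Subsingleton.elim c'' c] at hcard
  simp at hcard

end blowup

/-! ### Lower bound: alteration in the blow-up and choice of parameters. -/

instance (r n : ℕ) (p : unitInterval) : MeasureTheory.IsProbabilityMeasure (randomRGraph r n p) :=
  inferInstanceAs (MeasureTheory.IsProbabilityMeasure (ProbabilityTheory.setBernoulli _ p))

/-- A random `r`-graph contains a large subgraph of girth larger than `3` inside a sparse blow-up of
a linear triangle-free `r`-partite `r`-graph. -/
theorem randomRGraph_real_exGirth_ge {r n s : ℕ} {U : Type*} [Fintype U] (hr : 3 ≤ r)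
    {J : Finset (Fin r → U)} (hJ : IsLinearTriangleFree J)
    (hcard : r * (Fintype.card U * s) ≤ n) (p : unitInterval)
    (hpos : 0 < ((J.card * s ^ r : ℕ) : ℝ) * (p : ℝ)) {η : ℝ} (hη : 0 ≤ η)
    (hs : s = 1 ∨ (p : ℝ) * s ^ (r - 2) ≤ η ∧ (p : ℝ) ^ 2 * s ^ (2 * r - 3) ≤ η) :
    1 - (4 / (((J.card * s ^ r : ℕ) : ℝ) * (p : ℝ)) + 4 * ((r ^ 2 + r ^ 3) * η)) ≤
      (randomRGraph r n p).real {H | ((J.card * s ^ r : ℕ) : ℝ) * (p : ℝ) / 4 ≤ exGirth H 3} := by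
  classical
  have hemb : Nonempty (Fin r × U × Fin s ↪ Fin n) :=
    Function.Embedding.nonempty_of_card_le (by simpa using hcard)
  obtain ⟨φ⟩ := hemb
  set F := blowup φ J
  have hp0 : (0 : ℝ) ≤ p := p.2.1
  have hF : F.card = J.card * s ^ r := card_blowup J
  have hFu : (F : Set (Finset (Fin n))) ⊆ {e | e.card = r} := by
    intro e he
    obtain ⟨g, -, c, rfl⟩ := mem_blowup.1 he
    exact card_blowupEdge g c
  set B := bergeObstructions F 2 ∪ bergeObstructions F 3
  have hB : ∀ b ∈ B, b ⊆ F ∧ b.Nonempty := by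
    intro b hb
    rcases Finset.mem_union.1 hb with hb | hb
    · obtain ⟨h1, h2, -⟩ := mem_bergeObstructions.1 hb
      exact ⟨h1, Finset.card_pos.1 (by omega)⟩
    · obtain ⟨h1, h2, -⟩ := mem_bergeObstructions.1 hb
      exact ⟨h1, Finset.card_pos.1 (by omega)⟩
  have hsum : ∑ b ∈ B, (p : ℝ) ^ b.card ≤
      ((r ^ 2 + r ^ 3) * η) * (((J.card * s ^ r : ℕ) : ℝ) * (p : ℝ)) := by
    have h1 : ∑ b ∈ B, (p : ℝ) ^ b.card ≤ (bergeObstructions F 2).card * (p : ℝ) ^ 2 +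
        (bergeObstructions F 3).card * (p : ℝ) ^ 3 := by
      have hℓ : ∀ ℓ, ∑ b ∈ bergeObstructions F ℓ, (p : ℝ) ^ b.card =
          (bergeObstructions F ℓ).card * (p : ℝ) ^ ℓ := by
        intro ℓ
        rw [Finset.sum_congr rfl fun b hb ↦ by rw [(mem_bergeObstructions.1 hb).2.1]]
        simp
      rw [← hℓ, ← hℓ, ← Finset.sum_union_inter]
      exact le_add_of_nonneg_right (Finset.sum_nonneg fun b _ ↦ by positivity)
    refine h1.trans ?_
    rcases hs with hs | ⟨hs1, hs2⟩
    · rw [bergeObstructions_two_eq_empty hJ hs, bergeObstructions_three_eq_empty hJ hs]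
      simp only [Finset.card_empty, Nat.cast_zero, zero_mul, add_zero]
      positivity
    · have h2 : ((bergeObstructions F 2).card : ℝ) ≤
          J.card * (r ^ 2 * (s ^ r * s ^ (r - 2))) := by
        exact_mod_cast card_bergeObstructions_two_le (φ := φ) hJ
      have h3 : ((bergeObstructions F 3).card : ℝ) ≤
          J.card * (r ^ 3 * (s ^ r * s ^ (2 * r - 3))) := by
        have : 2 * r - 3 = (r - 1) + (r - 2) := by omega
        rw [this, pow_add]
        exact_mod_cast card_bergeObstructions_three_le (φ := φ) hJ
      -- Per expected edge, the expected numbers of 2-cycles and 3-cycles are of order `p s ^ (r -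
      -- 2)` and `p ^ 2 s ^ (2r - 3)`.
      calc ((bergeObstructions F 2).card : ℝ) * (p : ℝ) ^ 2 +
            (bergeObstructions F 3).card * (p : ℝ) ^ 3
          ≤ J.card * (r ^ 2 * (s ^ r * s ^ (r - 2))) * (p : ℝ) ^ 2 +
            J.card * (r ^ 3 * (s ^ r * s ^ (2 * r - 3))) * (p : ℝ) ^ 3 := by gcongr
        _ = (r ^ 2 * ((p : ℝ) * s ^ (r - 2)) + r ^ 3 * ((p : ℝ) ^ 2 * s ^ (2 * r - 3))) *
            (J.card * s ^ r * p) := by ring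
        _ ≤ (r ^ 2 * η + r ^ 3 * η) * (J.card * s ^ r * p) := by gcongr
        _ = _ := by push_cast; ring
  rw [← hF] at hpos hsum ⊢
  have hmain := setBernoulli_real_exists_avoiding_ge p F hFu hpos B (fun b hb ↦ (hB b hb).1)
    fun b hb ↦ (hB b hb).2
  have hdiv : 4 * (∑ b ∈ B, (p : ℝ) ^ b.card) / (F.card * (p : ℝ)) ≤
      4 * ((r ^ 2 + r ^ 3) * η) := by
    rw [div_le_iff₀ hpos]
    linarith
  refine (by linarith : _ ≤ _).trans (hmain.trans (MeasureTheory.measureReal_mono ?_))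
  rintro H ⟨G, hGF, hGH, hGB, hG⟩
  have hg : 3 < bergeGirth (G : Set (Finset (Fin n))) :=
    three_lt_bergeGirth_iff.2
      ⟨not_hasBergeCycle_of_avoids hGF fun b hb ↦ hGB b (Finset.mem_union_left _ hb),
        not_hasBergeCycle_of_avoids hGF fun b hb ↦ hGB b (Finset.mem_union_right _ hb)⟩
  have : G.card ≤ exGirth H 3 :=
    (isGreatest_exGirth H 3).2 ⟨G, hGH, hg, Set.ncard_coe_finset G⟩
  exact hG.trans (by exact_mod_cast this)

/-- The blow-up factor `s` and the box side `q`. -/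
theorem exists_blowup_parameters {r D n : ℕ} {θ L : ℝ} (hr : 1 ≤ r) (hD : 1 ≤ D) (hL : 1 ≤ L)
    (hθ : 0 < θ) (hθn : L ^ 2 ≤ θ ^ 2 * n) (hn : r ^ (D + 1) ≤ n)
    (hrL : (r : ℝ) ^ (D + 1) ≤ L ^ 3) :
    ∃ s q : ℕ, 1 ≤ s ∧ 1 ≤ q ∧ r * ((r * q) ^ D * s) ≤ n ∧ n ≤ r * ((2 * r * q) ^ D * s) ∧
      1 / (2 * L) ≤ θ ^ 2 * s ∧ (s = 1 ∨ θ ^ 2 * s ≤ 1 / L) := by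
  have hθL : 0 < θ ^ 2 * L := by positivity
  obtain ⟨s, hs1, hs2, hs3, hs4⟩ : ∃ s : ℕ, 1 ≤ s ∧ 1 / (2 * L) ≤ θ ^ 2 * s ∧
      (s = 1 ∨ θ ^ 2 * s ≤ 1 / L) ∧ r ^ (D + 1) * s ≤ n := by
    -- The target is `s = ⌊1 / (θ ^ 2 L)⌋`, replaced by `1` when the floor would vanish.
    rcases lt_or_ge (1 / (θ ^ 2 * L)) 1 with h | h
    · refine ⟨1, le_rfl, ?_, Or.inl rfl, by simpa using hn⟩
      rw [div_lt_one hθL] at h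
      rw [div_le_iff₀ (by positivity)]
      push_cast
      linarith
    · have hfl : (⌊1 / (θ ^ 2 * L)⌋₊ : ℝ) ≤ 1 / (θ ^ 2 * L) := Nat.floor_le (by positivity)
      have hfl1 : 1 ≤ ⌊1 / (θ ^ 2 * L)⌋₊ := Nat.le_floor (by simpa using h)
      have hfl2 := Nat.lt_floor_add_one (1 / (θ ^ 2 * L))
      have hfl1' : (1 : ℝ) ≤ ⌊1 / (θ ^ 2 * L)⌋₊ := by exact_mod_cast hfl1
      refine ⟨⌊1 / (θ ^ 2 * L)⌋₊, hfl1, ?_, Or.inr ?_, ?_⟩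
      · have h1 : 1 / (θ ^ 2 * L) ≤ 2 * (⌊1 / (θ ^ 2 * L)⌋₊ : ℝ) := by linarith
        rw [div_le_iff₀ hθL] at h1
        rw [div_le_iff₀ (by positivity)]
        linarith
      · rw [le_div_iff₀ hθL] at hfl
        rw [le_div_iff₀ (by positivity)]
        linarith
      · have h1 : (r : ℝ) ^ (D + 1) * (⌊1 / (θ ^ 2 * L)⌋₊ : ℝ) ≤ n := by
          calc (r : ℝ) ^ (D + 1) * (⌊1 / (θ ^ 2 * L)⌋₊ : ℝ) ≤ L ^ 3 * (1 / (θ ^ 2 * L)) := by gcongr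
            _ = L ^ 2 / θ ^ 2 := by field_simp
            _ ≤ n := by
              rw [div_le_iff₀ (by positivity)]
              linarith
        exact_mod_cast h1
  -- The last `q` for which the blow-up fits; `q + 1 ≤ 2 * q` then gives the reverse bound up to a
  -- constant factor.
  obtain ⟨q, hq1, hq2, hq3⟩ : ∃ q : ℕ, 1 ≤ q ∧ r * ((r * q) ^ D * s) ≤ n ∧
      n < r * ((r * (q + 1)) ^ D * s) := by
    by_contra! hcon
    have hall : ∀ q : ℕ, 1 ≤ q → r * ((r * q) ^ D * s) ≤ n := by
      intro q hq
      induction q, hq using Nat.le_induction with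
      | base =>
        calc r * ((r * 1) ^ D * s) = r ^ (D + 1) * s := by ring
          _ ≤ n := hs4
      | succ q hq ih => exact hcon q hq ih
    have h1 := hall (n + 1) (by omega)
    have h2 : n + 1 ≤ r * ((r * (n + 1)) ^ D * s) := by
      calc n + 1 ≤ r * (n + 1) := Nat.le_mul_of_pos_left _ hr
        _ ≤ (r * (n + 1)) ^ D := Nat.le_self_pow (by omega) _
        _ ≤ (r * (n + 1)) ^ D * s := Nat.le_mul_of_pos_right _ hs1
        _ ≤ _ := Nat.le_mul_of_pos_left _ hr
    omega
  refine ⟨s, q, hs1, hq1, hq2, hq3.le.trans ?_, hs2, hs3⟩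
  gcongr r * (?_ ^ D * s)
  rw [mul_comm 2 r, mul_assoc]
  gcongr
  omega

/-- The expected number of edges in the chosen sparse blow-up. -/
theorem le_expected_card_blowup {r D n s q j : ℕ} {p θ L ε : ℝ} (hr : 3 ≤ r) (hD : 1 ≤ D)
    (hL : 1 ≤ L) (hn : 1 ≤ n) (hs : 1 ≤ s) (hq : 1 ≤ q) (hθ : 0 < θ) (hp : θ ^ (2 * r - 3) = p)
    (hle : r * ((r * q) ^ D * s) ≤ n) (hge : n ≤ r * ((2 * r * q) ^ D * s))
    (hsθ : 1 / (2 * L) ≤ θ ^ 2 * s) (hj : q ^ D * q ^ D ≤ j * (D * q ^ 2 + 1))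
    (hε : 2 / (D : ℝ) ≤ ε / 2)
    (hlarge : 4 * ((r : ℝ) ^ 2 * (2 * r) ^ (2 * D) * (D + 1)) * (2 * L) ^ (r - 2) ≤
      (n : ℝ) ^ (ε / 2)) :
    θ * (n : ℝ) ^ (2 - ε) ≤ ((j * s ^ r : ℕ) : ℝ) * p / 4 := by
  have hnR : (1 : ℝ) ≤ n := by exact_mod_cast hn
  have hn0 : (0 : ℝ) < n := by linarith
  have hqR : (1 : ℝ) ≤ q := by exact_mod_cast hq
  have hqD : (q : ℝ) ^ D ≤ n := by
    have : q ^ D ≤ n := by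
      calc q ^ D ≤ (r * q) ^ D := Nat.pow_le_pow_left (Nat.le_mul_of_pos_left _ (by omega)) _
        _ ≤ (r * q) ^ D * s := Nat.le_mul_of_pos_right _ hs
        _ ≤ r * ((r * q) ^ D * s) := Nat.le_mul_of_pos_left _ (by omega)
        _ ≤ n := hle
    exact_mod_cast this
  have hDpos : (0 : ℝ) < D := by exact_mod_cast hD
  -- The loss `q ^ 2` from passing to a sphere is a small power of `n`, since `q ^ D ≤ n` and `D` is
  -- large. The other factor `n ^ (ε / 2)` is left for constants and logarithms.
  have hq2 : (q : ℝ) ^ 2 ≤ (n : ℝ) ^ (ε / 2) := by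
    calc (q : ℝ) ^ 2 = ((q : ℝ) ^ D) ^ (2 / (D : ℝ)) := by
          rw [← Real.rpow_natCast_mul (by positivity), mul_div_cancel₀ _ hDpos.ne',
            Real.rpow_ofNat]
      _ ≤ (n : ℝ) ^ (2 / (D : ℝ)) := by gcongr
      _ ≤ (n : ℝ) ^ (ε / 2) := Real.rpow_le_rpow_of_exponent_le hnR hε
  set C : ℝ := (r : ℝ) ^ 2 * (2 * r) ^ (2 * D) * (D + 1)
  have hgeR : (n : ℝ) ≤ r * ((2 * r * q) ^ D * s) := by exact_mod_cast hge
  have hjR : (q : ℝ) ^ D * q ^ D ≤ j * ((D + 1) * q ^ 2) := by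
    have h1 : (q : ℝ) ^ D * q ^ D ≤ j * (D * q ^ 2 + 1) := by exact_mod_cast hj
    refine h1.trans ?_
    gcongr
    nlinarith
  have hn2 : (n : ℝ) ^ 2 ≤ C * (j * s ^ 2) * q ^ 2 := by
    calc (n : ℝ) ^ 2 ≤ (r * ((2 * r * q) ^ D * s)) ^ 2 := by gcongr
      _ = (r : ℝ) ^ 2 * (2 * r) ^ (2 * D) * s ^ 2 * (q ^ D * q ^ D) := by
        rw [mul_pow (2 * (r : ℝ)), pow_mul']
        ring
      _ ≤ (r : ℝ) ^ 2 * (2 * r) ^ (2 * D) * s ^ 2 * (j * ((D + 1) * q ^ 2)) := by gcongr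
      _ = C * (j * s ^ 2) * q ^ 2 := by ring
  -- `s ^ (r - 2) p = θ (θ ^ 2 s) ^ (r - 2)`, and `θ ^ 2 s` is at least `1 / (2L)`.
  have hps : θ ≤ (2 * L) ^ (r - 2) * (s ^ (r - 2) * p) := by
    have h1 : (s : ℝ) ^ (r - 2) * p = θ * (θ ^ 2 * s) ^ (r - 2) := by
      rw [← hp, show 2 * r - 3 = 2 * (r - 2) + 1 by omega, mul_pow, pow_succ, pow_mul]
      ring
    have h2 : 1 ≤ 2 * L * (θ ^ 2 * s) := by
      rw [div_le_iff₀ (by positivity)] at hsθ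
      linarith
    rw [h1]
    calc θ = θ * 1 := (mul_one θ).symm
      _ ≤ θ * (2 * L * (θ ^ 2 * s)) ^ (r - 2) := by
        gcongr
        exact one_le_pow₀ h2
      _ = _ := by rw [mul_pow]; ring
  have hE : 0 < (n : ℝ) ^ (ε / 2) := by positivity
  have hp0 : 0 ≤ p := hp ▸ by positivity
  have hsplit : (n : ℝ) ^ (2 - ε) * ((n : ℝ) ^ (ε / 2) * (n : ℝ) ^ (ε / 2)) = (n : ℝ) ^ 2 := by
    rw [← Real.rpow_add hn0, ← Real.rpow_add hn0, ← Real.rpow_natCast]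
    congr 1
    push_cast
    ring
  have hfin : θ * (n : ℝ) ^ (2 - ε) * ((n : ℝ) ^ (ε / 2) * (n : ℝ) ^ (ε / 2)) ≤
      (((j * s ^ r : ℕ) : ℝ) * p / 4) * ((n : ℝ) ^ (ε / 2) * (n : ℝ) ^ (ε / 2)) := by
    calc θ * (n : ℝ) ^ (2 - ε) * ((n : ℝ) ^ (ε / 2) * (n : ℝ) ^ (ε / 2))
        = θ * (n : ℝ) ^ 2 := by rw [mul_assoc, hsplit]
      _ ≤ ((2 * L) ^ (r - 2) * (s ^ (r - 2) * p)) * (C * (j * s ^ 2) * q ^ 2) := by gcongr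
      _ ≤ ((2 * L) ^ (r - 2) * (s ^ (r - 2) * p)) * (C * (j * s ^ 2) * (n : ℝ) ^ (ε / 2)) := by
        gcongr
      _ = (4 * C * (2 * L) ^ (r - 2)) * (j * (s ^ (r - 2) * s ^ 2) * p / 4 * (n : ℝ) ^ (ε / 2)) := by
        ring
      _ ≤ (n : ℝ) ^ (ε / 2) * (j * (s ^ (r - 2) * s ^ 2) * p / 4 * (n : ℝ) ^ (ε / 2)) := by gcongr
      _ = _ := by
        rw [← pow_add, Nat.sub_add_cancel (by omega)]
        push_cast
        ring
  exact le_of_mul_le_mul_right hfin (by positivity)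

/-- First moment at `m = ⌈θ n ^ 2⌉`: the bound `2 ^ (-(2r - 3) m)` is below `1 / n` because `m ≥ n`.
-/
theorem randomRGraph_real_exGirth_le_ge {r n : ℕ} (hr : 3 ≤ r) {p : unitInterval} {θ ε : ℝ}
    (hθ : 0 < θ) (hp : θ ^ (2 * r - 3) = (p : ℝ)) (hn : 1 ≤ n) (hθn : 1 ≤ θ ^ 2 * n)
    (hε : 2 ≤ (n : ℝ) ^ ε) :
    1 - 1 / (n : ℝ) ≤
      (randomRGraph r n p).real {H | (exGirth H 3 : ℝ) ≤ θ * (n : ℝ) ^ (2 + ε)} := by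
  have hnR : (1 : ℝ) ≤ n := by exact_mod_cast hn
  have hn0 : (0 : ℝ) < n := by linarith
  have hθn2 : (n : ℝ) ≤ θ * n ^ 2 := by
    have : 1 ≤ θ * n := by
      by_contra! h
      have h1 : (θ * n) * (θ * n) < 1 := by nlinarith [mul_pos hθ hn0]
      nlinarith
    nlinarith
  set m := ⌈θ * (n : ℝ) ^ 2⌉₊
  have hm : θ * (n : ℝ) ^ 2 ≤ m := Nat.le_ceil _
  have hm' : (m : ℝ) < θ * (n : ℝ) ^ 2 + 1 := Nat.ceil_lt_add_one (by positivity)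
  have hk : 3 ≤ 2 * r - 3 := by omega
  have hK : 3 * (θ * (n : ℝ) ^ 2) ≤ (((2 * r - 3) * m : ℕ) : ℝ) := by
    have : 3 * m ≤ (2 * r - 3) * m := Nat.mul_le_mul_right _ hk
    have : (3 : ℝ) * m ≤ (((2 * r - 3) * m : ℕ) : ℝ) := by exact_mod_cast this
    linarith
  set A := {H : Set (Finset (Fin n)) | (exGirth H 3 : ℝ) ≤ θ * (n : ℝ) ^ (2 + ε)}
  have hsub : Aᶜ ⊆ {H | m ≤ exGirth H 3} := by
    intro H hH
    simp only [A, Set.mem_compl_iff, Set.mem_ofPred_eq, not_le] at hH ⊢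
    -- The factor `n ^ ε ≥ 2` absorbs the rounding in `m`.
    have h1 : (m : ℝ) ≤ θ * (n : ℝ) ^ (2 + ε) := by
      rw [Real.rpow_add hn0, Real.rpow_ofNat, ← mul_assoc]
      nlinarith
    exact_mod_cast (h1.trans_lt hH).le
  have hbound : (randomRGraph r n p).real Aᶜ ≤ 1 / n := by
    refine (MeasureTheory.measureReal_mono hsub).trans
      ((randomRGraph_real_le_exGirth_le (by omega) n m p).trans ?_)
    rw [← hp, ← pow_mul]
    refine (choose_mul_pow_le_half_pow hθ.le hK).trans ?_
    rw [one_div_pow]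
    have h1 : (((2 * r - 3) * m : ℕ) : ℝ) ≤ 2 ^ ((2 * r - 3) * m) := by
      exact_mod_cast Nat.lt_two_pow_self.le
    exact one_div_le_one_div_of_le hn0 (by linarith)
  have hc : (randomRGraph r n p).real Aᶜ = 1 - (randomRGraph r n p).real A :=
    MeasureTheory.probReal_compl_eq_one_sub MeasurableSet.of_discrete
  linarith

/-- Combines the Behrend graph, the blow-up and alteration; `1 / L` bounds the deletion ratio, and
`1 / n` comes from Chebyshev. -/
theorem randomRGraph_real_exGirth_ge_rpow {r n D : ℕ} (hr : 3 ≤ r) {p : unitInterval} {θ ε L : ℝ}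
    (hθ : 0 < θ) (hp : θ ^ (2 * r - 3) = (p : ℝ)) (hn : 1 ≤ n) (hL : 1 ≤ L)
    (hθn : L ^ 2 ≤ θ ^ 2 * n) (hε : ε ≤ 1 / 2) (hD : 1 ≤ D) (hDε : 2 / (D : ℝ) ≤ ε / 2)
    (hrn : r ^ (D + 1) ≤ n) (hrL : (r : ℝ) ^ (D + 1) ≤ L ^ 3)
    (hlarge : 4 * ((r : ℝ) ^ 2 * (2 * r) ^ (2 * D) * (D + 1)) * (2 * L) ^ (r - 2) ≤
      (n : ℝ) ^ (ε / 2)) :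
    1 - (1 / (n : ℝ) + 4 * ((r ^ 2 + r ^ 3) * (1 / L))) ≤
      (randomRGraph r n p).real {H | θ * (n : ℝ) ^ (2 - ε) ≤ (exGirth H 3 : ℝ)} := by
  have hnR : (1 : ℝ) ≤ n := by exact_mod_cast hn
  have hn0 : (0 : ℝ) < n := by linarith
  have hL0 : 0 < L := by linarith
  have hp1 : (p : ℝ) ≤ 1 := p.2.2
  have hθ1 : θ ≤ 1 := (pow_le_one_iff_of_nonneg hθ.le (by omega)).1 (hp ▸ hp1)
  obtain ⟨s, q, hs, hq, hle, hge, hsθ, hcase⟩ :=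
    exists_blowup_parameters (by omega) hD hL hθ hθn hrn hrL
  obtain ⟨J, hJ, hj⟩ := exists_isLinearTriangleFree (r := r) (by omega) D q
  have hmean := le_expected_card_blowup hr hD hL hn hs hq hθ hp hle hge hsθ hj hDε hlarge
  -- Here `ε ≤ 1 / 2` enters, together with `θ n ^ (1 / 2) ≥ 1`.
  have hmean' : (n : ℝ) ≤ θ * (n : ℝ) ^ (2 - ε) := by
    have h1 : (1 : ℝ) ≤ θ * (n : ℝ) ^ (1 / 2 : ℝ) := by
      have h2 : (θ * (n : ℝ) ^ (1 / 2 : ℝ)) ^ 2 = θ ^ 2 * n := by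
        rw [mul_pow, ← Real.sqrt_eq_rpow, Real.sq_sqrt hn0.le]
      rw [← one_le_sq_iff₀ (by positivity), h2]
      nlinarith
    calc (n : ℝ) = 1 * n := (one_mul _).symm
      _ ≤ θ * (n : ℝ) ^ (1 / 2 : ℝ) * n := by gcongr
      _ = θ * (n : ℝ) ^ (1 / 2 + 1 : ℝ) := by
        rw [Real.rpow_add hn0, Real.rpow_one, mul_assoc]
      _ ≤ θ * (n : ℝ) ^ (2 - ε) := by
        gcongr ?_ * ?_
        exact Real.rpow_le_rpow_of_exponent_le hnR (by linarith)
  have hpos : 0 < ((J.card * s ^ r : ℕ) : ℝ) * (p : ℝ) := by linarith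
  have hcard : r * (Fintype.card (Fin D → Fin (r * q)) * s) ≤ n := by simpa using hle
  have hη : s = 1 ∨ (p : ℝ) * s ^ (r - 2) ≤ 1 / L ∧ (p : ℝ) ^ 2 * s ^ (2 * r - 3) ≤ 1 / L := by
    refine hcase.imp_right fun h ↦ ?_
    have hL1 : 1 / L ≤ 1 := by
      rw [div_le_one hL0]
      exact hL
    have hx : 0 ≤ θ ^ 2 * s := by positivity
    have hpow : ∀ t : ℕ, t ≠ 0 → (θ ^ 2 * s) ^ t ≤ 1 / L := fun t ht ↦
      (pow_le_of_le_one hx (h.trans hL1) ht).trans h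
    constructor
    · have h1 : (p : ℝ) * s ^ (r - 2) = θ * (θ ^ 2 * s) ^ (r - 2) := by
        rw [← hp, show 2 * r - 3 = 2 * (r - 2) + 1 by omega, mul_pow, pow_succ, pow_mul]
        ring
      rw [h1]
      exact (mul_le_of_le_one_left (by positivity) hθ1).trans (hpow _ (by omega))
    · rw [← hp, ← pow_mul, mul_comm (2 * r - 3), pow_mul, ← mul_pow]
      exact hpow _ (by omega)
  have hmain := randomRGraph_real_exGirth_ge hr hJ hcard p hpos (by positivity) hη
  have h4 : 4 / (((J.card * s ^ r : ℕ) : ℝ) * (p : ℝ)) ≤ 1 / n := by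
    rw [div_le_div_iff₀ hpos hn0]
    linarith
  refine (by linarith : _ ≤ _).trans (hmain.trans (MeasureTheory.measureReal_mono ?_))
  intro H hH
  exact hmean.trans hH

/-! ### Uniform estimate and diagonal choice of `ε`. -/

/-- Quantitative form of the two-sided estimate, uniform in the edge probability. -/
theorem eventually_forall_randomRGraph_real_ge {r : ℕ} (hr : 3 ≤ r) {ε : ℝ} (hε : 0 < ε)
    (hε2 : ε ≤ 1 / 2) :
    ∀ᶠ n : ℕ in atTop, ∀ p : unitInterval,
      (n : ℝ) ^ (-(r : ℝ) + 3 / 2) * Real.log (n : ℝ) ^ (2 * r - 3) ≤ (p : ℝ) →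
      1 - ε ≤ (randomRGraph r n p).real {H |
        (p : ℝ) ^ (1 / (2 * (r : ℝ) - 3)) * (n : ℝ) ^ (2 - ε) ≤ (exGirth H 3 : ℝ) ∧
        (exGirth H 3 : ℝ) ≤ (p : ℝ) ^ (1 / (2 * (r : ℝ) - 3)) * (n : ℝ) ^ (2 + ε)} := by
  obtain ⟨D, hD⟩ := exists_nat_ge (4 / ε)
  have hD0 : (0 : ℝ) < D := lt_of_lt_of_le (by positivity) hD
  have hD1 : 1 ≤ D := by exact_mod_cast hD0
  have hDε : 2 / (D : ℝ) ≤ ε / 2 := by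
    rw [div_le_iff₀ hε] at hD
    rw [div_le_iff₀ hD0]
    linarith
  have hlog : Tendsto (fun n : ℕ ↦ Real.log n) atTop atTop :=
    Real.tendsto_log_atTop.comp tendsto_natCast_atTop_atTop
  set C : ℝ := 4 * ((r : ℝ) ^ 2 * (2 * r) ^ (2 * D) * (D + 1))
  have e1 : ∀ᶠ n : ℕ in atTop, 1 ≤ Real.log n := hlog.eventually_ge_atTop 1
  have e2 : ∀ᶠ n : ℕ in atTop, (r : ℝ) ^ (D + 1) ≤ Real.log n ^ 3 :=
    ((tendsto_pow_atTop (by norm_num)).comp hlog).eventually_ge_atTop _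
  have e3 : ∀ᶠ n : ℕ in atTop, C * (2 * Real.log n) ^ (r - 2) ≤ (n : ℝ) ^ (ε / 2) := by
    have h1 : (fun x : ℝ ↦ C * 2 ^ (r - 2) * Real.log x ^ (r - 2)) =o[atTop]
        fun x ↦ x ^ (ε / 2) := by
      have := isLittleO_log_rpow_rpow_atTop ((r - 2 : ℕ) : ℝ) (half_pos hε)
      simp only [Real.rpow_natCast] at this
      exact this.const_mul_left _
    have h2 := tendsto_natCast_atTop_atTop.eventually (h1.bound one_pos)
    filter_upwards [h2] with n hn
    rw [one_mul, Real.norm_of_nonneg (by positivity : (0 : ℝ) ≤ (n : ℝ) ^ (ε / 2))] at hn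
    rw [mul_pow, ← mul_assoc]
    exact (Real.le_norm_self _).trans hn
  have e4 : ∀ᶠ n : ℕ in atTop, 2 ≤ (n : ℝ) ^ ε :=
    ((tendsto_rpow_atTop hε).comp tendsto_natCast_atTop_atTop).eventually_ge_atTop 2
  have e5 : ∀ᶠ n : ℕ in atTop,
      2 * (1 / (n : ℝ)) + 4 * (((r : ℝ) ^ 2 + r ^ 3) * (1 / Real.log n)) ≤ ε := by
    have h1 : Tendsto (fun n : ℕ ↦ 2 * (1 / (n : ℝ)) +
        4 * (((r : ℝ) ^ 2 + r ^ 3) * (1 / Real.log n))) atTop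
        (𝓝 (2 * 0 + 4 * (((r : ℝ) ^ 2 + r ^ 3) * 0))) := by
      refine ((tendsto_one_div_atTop_nhds_zero_nat (𝕜 := ℝ)).const_mul 2).add
        (Tendsto.const_mul 4 (Tendsto.const_mul _ ?_))
      simp only [one_div]
      exact hlog.inv_tendsto_atTop
    simp only [mul_zero, add_zero] at h1
    exact (h1.eventually_lt_const hε).mono fun _ h ↦ h.le
  filter_upwards [e1, e2, e3, e4, e5, eventually_ge_atTop 1, eventually_ge_atTop (r ^ (D + 1))]
    with n h1 h2 h3 h4 h5 h6 h7 p hp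
  have hn0 : (0 : ℝ) < n := by exact_mod_cast h6
  have hL0 : 0 < Real.log n := by linarith
  set θ : ℝ := (p : ℝ) ^ (1 / (2 * (r : ℝ) - 3))
  have hcast : ((2 * r - 3 : ℕ) : ℝ) = 2 * (r : ℝ) - 3 := by
    rw [Nat.cast_sub (by omega)]
    push_cast
    ring
  have hk0 : 2 * r - 3 ≠ 0 := by omega
  have hθp : θ ^ (2 * r - 3) = (p : ℝ) := by
    simp only [θ]
    rw [← hcast, one_div, Real.rpow_inv_natCast_pow p.2.1 hk0]
  have hθ0 : 0 ≤ θ := Real.rpow_nonneg p.2.1 _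
  -- The `(2r - 3)`-th root of the hypothesis on `p`; the exponents match since `(2r - 3) / 2 = r -
  -- 3 / 2`.
  have hθ1 : (n : ℝ) ^ (-(1 / 2) : ℝ) * Real.log n ≤ θ := by
    rw [← pow_le_pow_iff_left₀ (by positivity) hθ0 hk0, hθp, mul_pow, ← Real.rpow_mul_natCast hn0.le,
      hcast]
    have hexp : -(1 / 2) * (2 * (r : ℝ) - 3) = -(r : ℝ) + 3 / 2 := by ring
    rwa [hexp]
  have hθ : 0 < θ := lt_of_lt_of_le (by positivity) hθ1
  have hθn : Real.log n ^ 2 ≤ θ ^ 2 * n := by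
    calc Real.log n ^ 2 = ((n : ℝ) ^ (-(1 / 2) : ℝ) * Real.log n) ^ 2 * n := by
          rw [mul_pow, ← Real.rpow_mul_natCast hn0.le]
          norm_num
          rw [Real.rpow_neg_one]
          field_simp
      _ ≤ θ ^ 2 * n := by gcongr
  have hup := randomRGraph_real_exGirth_le_ge hr hθ hθp h6 (le_trans (by nlinarith) hθn) h4
  have hlow := randomRGraph_real_exGirth_ge_rpow hr hθ hθp h6 h1 hθn hε2 hD1 hDε h7 h2 h3
  set A := {H : Set (Finset (Fin n)) | θ * (n : ℝ) ^ (2 - ε) ≤ (exGirth H 3 : ℝ)}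
  set A' := {H : Set (Finset (Fin n)) | (exGirth H 3 : ℝ) ≤ θ * (n : ℝ) ^ (2 + ε)}
  have hun := MeasureTheory.measureReal_union_add_inter (μ := randomRGraph r n p) (s := A)
    (t := A') MeasurableSet.of_discrete
  have hle1 : (randomRGraph r n p).real (A ∪ A') ≤ 1 := MeasureTheory.measureReal_le_one
  change 1 - ε ≤ (randomRGraph r n p).real (A ∩ A')
  linarith

/-- If each of countably many properties holds eventually, so does a diagonal choice among them. -/
theorem exists_tendsto_atTop_eventually {P : ℕ → ℕ → Prop} (h : ∀ k, ∀ᶠ n in atTop, P k n) :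
    ∃ κ : ℕ → ℕ, Tendsto κ atTop atTop ∧ ∀ᶠ n in atTop, P (κ n) n := by
  classical
  refine ⟨fun n ↦ Nat.findGreatest (fun k ↦ P k n) n, ?_, ?_⟩
  · refine tendsto_atTop.2 fun k ↦ ?_
    filter_upwards [h k, eventually_ge_atTop k] with n hn hk
    exact Nat.le_findGreatest hk hn
  · filter_upwards [h 0] with n hn
    exact Nat.findGreatest_spec (P := fun k ↦ P k n) (Nat.zero_le n) hn

theorem theorem1p4 (r : ℕ) (hr : 3 ≤ r) :
    ∃ ε : ℕ → ℝ, Tendsto ε atTop (𝓝 0) ∧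
      ∀ p : ℕ → unitInterval,
        (∀ᶠ n : ℕ in atTop,
          (n : ℝ) ^ (-(r : ℝ) + 3 / 2) * Real.log (n : ℝ) ^ (2 * r - 3) ≤ (p n : ℝ)) →
        RandomRGraphAAS r p (fun n H =>
          (p n : ℝ) ^ (1 / (2 * (r : ℝ) - 3)) * (n : ℝ) ^ (2 - ε n) ≤ (exGirth H 3 : ℝ) ∧
          (exGirth H 3 : ℝ) ≤ (p n : ℝ) ^ (1 / (2 * (r : ℝ) - 3)) * (n : ℝ) ^ (2 + ε n)) := by
  -- The shift by `2` keeps `ε ≤ 1 / 2` already at `k = 0`. The diagonalised property quantifies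
  -- over all `p`, so `κ` does not depend on the sequence `p`.
  obtain ⟨κ, hκ, hev⟩ := exists_tendsto_atTop_eventually fun k : ℕ ↦
    eventually_forall_randomRGraph_real_ge hr (ε := 1 / ((k : ℝ) + 2)) (by positivity)
      (one_div_le_one_div_of_le two_pos (by linarith [k.cast_nonneg (α := ℝ)]))
  have hε : Tendsto (fun n ↦ 1 / ((κ n : ℝ) + 2)) atTop (𝓝 0) := by
    have h1 : Tendsto (fun n ↦ (κ n : ℝ) + 2) atTop atTop :=
      tendsto_atTop_add_const_right _ _ (tendsto_natCast_atTop_atTop.comp hκ)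
    simp only [one_div]
    exact h1.inv_tendsto_atTop
  refine ⟨fun n ↦ 1 / ((κ n : ℝ) + 2), hε, fun p hp ↦ ?_⟩
  refine tendsto_of_tendsto_of_tendsto_of_le_of_le' (g := fun n ↦ 1 - 1 / ((κ n : ℝ) + 2))
    (h := fun _ ↦ 1) ?_ tendsto_const_nhds ?_
    (Eventually.of_forall fun n ↦ MeasureTheory.measureReal_le_one)
  · simpa using hε.const_sub 1
  · filter_upwards [hev, hp] with n hn hpn
    exact hn (p n) hpn
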